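/- For a positive integer $n$ and an elliptic curve $E$ over $\mathbb{Q}$, let $\mathbb{Q}(E[n])\subset\overline{\mathbb{Q}}$ be the field generated by the coordinates of the points of $E(\overline{\mathbb{Q}})$ killed by $n$. The conductor of an abelian extension $K/\mathbb{Q}$ is the smallest positive integer $n$ with $K\subseteq\mathbb{Q}(\zeta_n)$. (1) Let $E$ be an elliptic curve over $\mathbb{Q}$ such that $\mathrm{Gal}(\mathbb{Q}(E[4])/\mathbb{Q})$ is abelian and $\mathbb{Q}(E[2])=\mathbb{Q}(i)$. Suppose that the conductor of $\mathbb{Q}(E[4])/\mathbb{Q}$ is $4j$ with $j$ odd. Then $\mathbb{Q}(E[2j])=\mathbb{Q}(E[4j])$. (2) Let $E$ be an elliptic curve over $\mathbb{Q}$ such that $\mathrm{Gal}(\mathbb{Q}(E[8])/\mathbb{Q})$ is abelian and $\zeta_8\in\mathbb{Q}(E[4])$. Suppose that the conductor of $\mathbb{Q}(E[8])/\mathbb{Q}$ is $8j$ for an integer $j$. Then $j$ is odd and $\mathbb{Q}(E[4j])=\mathbb{Q}(E[8j])$. -/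

import Mathlib

noncomputable section

/-- The field `ℚ(E[n])` inside a fixed algebraic closure of `ℚ`: it is generated over `ℚ` by the
affine coordinates of all the (nonzero) points of `E` over the algebraic closure that are killed
by `n`. -/
def divisionField (E : WeierstrassCurve ℚ) (n : ℕ) :
    IntermediateField ℚ (AlgebraicClosure ℚ) :=
  letI : DecidableEq (AlgebraicClosure ℚ) := Classical.decEq _
  IntermediateField.adjoin ℚ
    {z | ∃ (x y : AlgebraicClosure ℚ)
        (h : (E.baseChange (AlgebraicClosure ℚ)).toAffine.Nonsingular x y),
        n • WeierstrassCurve.Affine.Point.some x y h = 0 ∧ (z = x ∨ z = y)}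

/-- The cyclotomic field `ℚ(ζ_n)` inside the same algebraic closure. -/
def cyclotomicSubfield (n : ℕ) : IntermediateField ℚ (AlgebraicClosure ℚ) :=
  IntermediateField.adjoin ℚ {z | IsPrimitiveRoot z n}

/-- The field `ℚ(i)` inside the same algebraic closure. -/
def gaussianSubfield : IntermediateField ℚ (AlgebraicClosure ℚ) :=
  IntermediateField.adjoin ℚ {z | z ^ 2 = -1}

/-- `n` is the conductor of the abelian extension `K / ℚ`: the smallest positive integer `n` such
that `K` is contained in `ℚ(ζ_n)`. -/
def IsConductor (K : IntermediateField ℚ (AlgebraicClosure ℚ)) (n : ℕ) : Prop :=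
  IsLeast {m : ℕ | 0 < m ∧ K ≤ cyclotomicSubfield m} n

end

/-! Let n = 4 in (1) and n = 8 in (2), so that the conductor is N = nj. The main point is that every
automorphism acts on E[n] as an involution. Then ℚ(E[n]) lies in the largest subfield of ℚ(ζ_N) of
exponent two, generated by ζ_{gcd(N,8)} and the square roots of (-1)^((p-1)/2) p for odd primes p ∣
N (`le_of_le_cyclotomicSubfield`). By hypothesis the root of unity lies in ℚ(E[n/2]), and each
square root lies in ℚ(E[p]). Hence ℚ(E[n]) ≤ ℚ(E[nj/2]), and the compositum with ℚ(E[j]), j odd, is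
ℚ(E[nj]). In (2) the same generators lie in ℚ(ζ_{8m}), m the odd part of j, so minimality of the
conductor makes j odd.

The square root in ℚ(E[p]) comes from division polynomials, not from the Weil pairing. The product
of 2y + a₁x + a₃ over the roots of the p-division polynomial has a square computable from the values
of that polynomial at the 2-torsion (`exists_sq_eq_of_etaCoord_mem`). This needs the roots to be
p-torsion (`nsmul_eq_zero_of_psiValue_eq_zero`).

For the involutions, complex conjugation c commutes with everything. In (1), σ or σc fixes E[2],
hence is an involution on E[4]. In (2), c is trivial on E[2] and differs from ±1 on E[4], so E[8]
has a basis of eigenvectors of c; anything commuting with c is diagonal modulo 4 and squares to 1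
modulo 8 (`apply_apply_eq_of_commute_involution`). Triviality of c on E[2] is the arithmetic core:
if c swapped two of these points, radicals in the abelian field ℚ(E[8]) would give a nontrivial
rational solution of m⁴ + N⁴ = w² (`false_of_conj_swap`). -/

section

open WeierstrassCurve WeierstrassCurve.Affine Polynomial

/-! ### Addition and duplication formulas in terms of x-coordinates. -/

section XCoordinates

variable {F : Type*} [Field F] {W : WeierstrassCurve.Affine F}

/-- The `x`-coordinate of a point, with value `0` at the point at infinity. -/
def xCoord {F : Type*} [Field F] {W : WeierstrassCurve.Affine F} : W.Point → F
  | .zero => 0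
  | .some x _ _ => x

/-- The value of `2y + a₁x + a₃` at a point, with value `0` at the point at infinity. -/
def etaCoord {F : Type*} [Field F] {W : WeierstrassCurve.Affine F} : W.Point → F
  | .zero => 0
  | .some x y _ => 2 * y + W.a₁ * x + W.a₃

@[simp] lemma xCoord_some {x y : F} (h : W.Nonsingular x y) : xCoord (Point.some x y h) = x := rfl

@[simp] lemma etaCoord_some {x y : F} (h : W.Nonsingular x y) :
    etaCoord (Point.some x y h) = 2 * y + W.a₁ * x + W.a₃ := rfl

lemma exists_eq_some {P : W.Point} (hP : P ≠ 0) : ∃ x y h, P = Point.some x y h := by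
  cases P with
  | zero => exact absurd rfl hP
  | some x y h => exact ⟨x, y, h, rfl⟩

lemma xCoord_neg (P : W.Point) : xCoord (-P) = xCoord P := by
  cases P <;> rfl

lemma xCoord_eq_iff {P Q : W.Point} (hP : P ≠ 0) (hQ : Q ≠ 0) :
    xCoord P = xCoord Q ↔ P = Q ∨ P = -Q := by
  obtain ⟨x, y, h, rfl⟩ := exists_eq_some hP
  obtain ⟨x', y', h', rfl⟩ := exists_eq_some hQ
  exact Point.X_eq_iff

lemma etaCoord_sq {P : W.Point} (hP : P ≠ 0) :
    etaCoord P ^ 2 = 4 * xCoord P ^ 3 + W.b₂ * xCoord P ^ 2 + 2 * W.b₄ * xCoord P + W.b₆ := by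
  obtain ⟨x, y, h, rfl⟩ := exists_eq_some hP
  have := (W.equation_iff x y).1 h.1
  simp only [etaCoord_some, xCoord_some, b₂, b₄, b₆]
  linear_combination 4 * this

/-- The symmetric polynomial in the `x`-coordinates of three points whose vanishing expresses that
one of the points is, up to sign, the sum or the difference of the other two. -/
def tripleForm (W : WeierstrassCurve.Affine F) (a b z : F) : F :=
  ((a * b) ^ 2 - W.b₄ * (a * b) - W.b₆ * (a + b) - W.b₈)
    - z * (2 * a * b * (a + b) + W.b₂ * (a * b) + W.b₄ * (a + b) + W.b₆) + z ^ 2 * (a - b) ^ 2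

/-- By this symmetry, (x(P+Q) - x(R)) (x(P-Q) - x(R)) (x(P) - x(Q))² keeps its value when P, Q, R
are permuted cyclically. It drives the induction for elliptic sequences. -/
lemma tripleForm_rotate (a b z : F) : tripleForm W a b z = tripleForm W b z a := by
  unfold tripleForm; ring

variable [DecidableEq F]

lemma etaCoord_eq_zero_iff {P : W.Point} (hP : P ≠ 0) : etaCoord P = 0 ↔ 2 • P = 0 := by
  obtain ⟨x, y, h, rfl⟩ := exists_eq_some hP
  rw [two_nsmul, add_eq_zero_iff_eq_neg, Point.neg_some, Point.some.injEq, etaCoord_some, negY]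
  constructor
  · exact fun h => ⟨rfl, by linear_combination h⟩
  · rintro ⟨-, h⟩
    linear_combination h

lemma xCoord_add_sub {P Q : W.Point} (hP : P ≠ 0) (hQ : Q ≠ 0) (h : xCoord P ≠ xCoord Q) (z : F) :
    (xCoord (P + Q) - z) * (xCoord (P - Q) - z) * (xCoord P - xCoord Q) ^ 2 =
      tripleForm W (xCoord P) (xCoord Q) z := by
  obtain ⟨x, y, h₁, rfl⟩ := exists_eq_some hP
  obtain ⟨x', y', h₂, rfl⟩ := exists_eq_some hQ
  simp only [xCoord_some] at h ⊢
  have e₁ := (W.equation_iff x y).1 h₁.1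
  have e₂ := (W.equation_iff x' y').1 h₂.1
  have h0 : x - x' ≠ 0 := sub_ne_zero.2 h
  rw [sub_eq_add_neg (Point.some x y h₁), Point.neg_some, Point.add_of_X_ne h, Point.add_of_X_ne h]
  simp only [xCoord_some, addX, slope_of_X_ne h, negY, tripleForm, b₂, b₄, b₆, b₈]
  field_simp
  grind

lemma xCoord_two_nsmul {P : W.Point} (h2 : 2 • P ≠ 0) :
    xCoord (2 • P) * etaCoord P ^ 2 = xCoord P ^ 4 - W.b₄ * xCoord P ^ 2
      - 2 * W.b₆ * xCoord P - W.b₈ := by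
  have hP : P ≠ 0 := by rintro rfl; simp at h2
  have hη := mt (etaCoord_eq_zero_iff hP).1 h2
  obtain ⟨x, y, h, rfl⟩ := exists_eq_some hP
  have e := (W.equation_iff x y).1 h.1
  simp only [etaCoord_some, xCoord_some] at hη ⊢
  have hy : y ≠ W.negY x y := by
    intro h; apply hη; rw [negY] at h; linear_combination h
  have hs : y - W.negY x y = 2 * y + W.a₁ * x + W.a₃ := by rw [negY]; ring
  rw [two_nsmul, Point.add_self_of_Y_ne hy]
  simp only [xCoord_some, addX, slope_of_Y_ne rfl hy, hs, b₄, b₆, b₈]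
  have hη' : 2 * y + x * W.a₁ + W.a₃ ≠ 0 := by rwa [mul_comm x]
  generalize hd : 2 * y + W.a₁ * x + W.a₃ = d at *
  clear hs hy hη' h2 hP h
  field_simp
  grind

end XCoordinates

end

section

open WeierstrassCurve WeierstrassCurve.Affine Polynomial

/-! ### The elliptic sequence attached to the multiples of a point. -/

section DivisionValues

variable {F : Type*} [Field F] {W : WeierstrassCurve.Affine F}

/-- The value of the `n`-division polynomial at a nonzero point. -/
noncomputable def psiValue (P : W.Point) (n : ℤ) : F :=
  normEDS (etaCoord P) (W.Ψ₃.eval (xCoord P)) (W.preΨ₄.eval (xCoord P)) n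

variable [DecidableEq F]

/-- The sequence determined by `x(P) - x(nP) = w (n + 1) * w (n - 1) / w n ^ 2`. -/
noncomputable def multSeq (P : W.Point) : ℕ → F
  | 0 => 0
  | 1 => 1
  | 2 => etaCoord P
  | n + 3 => (xCoord P - xCoord ((n + 2) • P)) * multSeq P (n + 2) ^ 2 / multSeq P (n + 1)

variable {P : W.Point} {K : ℕ}

/-- Equality would mean kP = ±P, so that (k - 1)P or (k + 1)P vanishes; hence the bound on k + 1. -/
lemma xCoord_nsmul_ne (hK : ∀ k, 1 ≤ k → k ≤ K → k • P ≠ 0) {k : ℕ} (hk : 2 ≤ k)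
    (hkK : k + 1 ≤ K) : xCoord P ≠ xCoord (k • P) := by
  have h1 : P ≠ 0 := by simpa using hK 1 le_rfl (by omega)
  intro h
  obtain ⟨m, rfl⟩ : ∃ m, k = m + 1 := ⟨k - 1, by omega⟩
  rcases (xCoord_eq_iff h1 (hK _ (by omega) (by omega))).1 h with h | h
  · exact hK m (by omega) (by omega) (by rwa [succ_nsmul, eq_comm, add_eq_right] at h)
  · exact hK (m + 1 + 1) (by omega) hkK (by rw [succ_nsmul]; nth_rw 2 [h]; exact add_neg_cancel _)

lemma multSeq_ne_zero (hK : ∀ k, 1 ≤ k → k ≤ K → k • P ≠ 0) :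
    ∀ k, 1 ≤ k → k ≤ K → multSeq P k ≠ 0
  | 0, h, _ => by omega
  | 1, _, _ => one_ne_zero
  | 2, _, h => by
    have h1 : P ≠ 0 := by simpa using hK 1 le_rfl (by omega)
    exact mt (etaCoord_eq_zero_iff h1).1 (hK 2 (by omega) h)
  | n + 3, _, h => div_ne_zero (mul_ne_zero (sub_ne_zero.2 (xCoord_nsmul_ne hK (by omega) h))
      (pow_ne_zero 2 (multSeq_ne_zero hK (n + 2) (by omega) (by omega))))
      (multSeq_ne_zero hK (n + 1) (by omega) (by omega))

lemma multSeq_step (hK : ∀ k, 1 ≤ k → k ≤ K → k • P ≠ 0) {n : ℕ} (hn : n + 1 ≤ K) :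
    (xCoord P - xCoord ((n + 1) • P)) * multSeq P (n + 1) ^ 2 =
      multSeq P (n + 2) * multSeq P n := by
  cases n with
  | zero => simp [multSeq]
  | succ n =>
    have := multSeq_ne_zero hK (n + 1) (by omega) (by omega)
    rw [multSeq]
    field_simp

/-- The defining recursion is the case b = 1. Stepping up in b trades (b, d) for (b - 1, d + 1) and
(b - 2, d + 2), which keep b + d fixed. The bound 2b + d ≤ K + 1 allows one index past the known
nonzero multiples, since `multSeq` divides only by earlier terms. -/
lemma xCoord_sub_mul_multSeq_sq (hK : ∀ k, 1 ≤ k → k ≤ K → k • P ≠ 0) :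
    ∀ b d : ℕ, 1 ≤ b → 1 ≤ d → 2 * b + d ≤ K + 1 →
      (xCoord (b • P) - xCoord ((b + d) • P)) * multSeq P (b + d) ^ 2 * multSeq P b ^ 2 =
        multSeq P (2 * b + d) * multSeq P d := by
  intro b
  induction b using Nat.strong_induction_on with
  | _ b ih =>
  intro d hb hd hbd
  have h1 : P ≠ 0 := by simpa using hK 1 le_rfl (by omega)
  obtain rfl | rfl | ⟨b, rfl⟩ : b = 1 ∨ b = 2 ∨ ∃ b', b = b' + 3 :=
    if h : b ≤ 2 then by omega else .inr (.inr ⟨b - 3, by omega⟩)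
  · have := multSeq_step hK (n := d) (by omega)
    rw [one_nsmul, add_comm 1 d, this, show 2 * 1 + d = d + 2 by ring]
    simp [multSeq]
  · have s1 := multSeq_step hK (n := d) (by omega)
    have s2 := multSeq_step hK (n := d + 1) (by omega)
    have s3 := multSeq_step hK (n := d + 2) (by omega)
    have w1 := multSeq_ne_zero hK (d + 1) (by omega) (by omega)
    have w2 := multSeq_ne_zero hK (d + 3) (by omega) (by omega)
    have n2 := hK 2 (by omega) (by omega)
    have key := xCoord_add_sub (hK (d + 2) (by omega) (by omega)) h1
      (xCoord_nsmul_ne hK (k := d + 2) (by omega) (by omega)).symm (xCoord P)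
    have dbl := xCoord_two_nsmul n2
    have sq := etaCoord_sq h1
    rw [← succ_nsmul, show (d + 2) • P - P = (d + 1) • P by rw [succ_nsmul _ (d + 1)]; abel] at key
    simp only [tripleForm] at key
    rw [show 2 * 2 + d = d + 4 by ring, add_comm 2 d]
    change _ * multSeq P (d + 2) ^ 2 * etaCoord P ^ 2 = _
    simp only [show d + 2 + 1 = d + 3 by ring, show d + 1 + 1 = d + 2 by ring,
      show d + 2 + 2 = d + 4 by ring] at *
    have key' : etaCoord P ^ 2 * (xCoord (2 • P) - xCoord ((d + 2) • P)) =
        (xCoord ((d + 3) • P) - xCoord P) * (xCoord ((d + 1) • P) - xCoord P) *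
          (xCoord ((d + 2) • P) - xCoord P) ^ 2 := by
      linear_combination dbl - key - xCoord ((d + 2) • P) * sq
    have w3 := multSeq_ne_zero hK (d + 2) (by omega) (by omega)
    generalize xCoord (2 • P) = x₂, xCoord ((d + 3) • P) = X₃, xCoord ((d + 2) • P) = X₂,
      xCoord ((d + 1) • P) = X₁, xCoord P = x, multSeq P d = v₀, multSeq P (d + 1) = v₁,
      multSeq P (d + 2) = v₂, multSeq P (d + 3) = v₃, multSeq P (d + 4) = v₄ at *
    apply mul_left_cancel₀ (mul_ne_zero (mul_ne_zero (pow_ne_zero 2 w1) (pow_ne_zero 2 w2))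
      (pow_ne_zero 2 w3))
    linear_combination v₁ ^ 2 * v₃ ^ 2 * v₂ ^ 4 * key' +
      (x - X₃) * v₃ ^ 2 * ((x - X₂) * v₂ ^ 2) ^ 2 * s1 +
      v₂ * v₀ * ((x - X₂) * v₂ ^ 2) ^ 2 * s3 +
      v₂ * v₀ * (v₄ * v₂) * ((x - X₂) * v₂ ^ 2 + v₃ * v₁) * s2
  · have i1 := ih (b + 2) (by omega) (d + 1) (by omega) (by omega) (by omega)
    have i2 := ih (b + 1) (by omega) (d + 2) (by omega) (by omega) (by omega)
    have ss := multSeq_step hK (n := 2 * b + d + 4) (by omega)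
    have sd := multSeq_step hK (n := d) (by omega)
    have sb := multSeq_step hK (n := b + 1) (by omega)
    have wd1 := multSeq_ne_zero hK (d + 1) (by omega) (by omega)
    have wd2 := multSeq_ne_zero hK (d + 2) (by omega) (by omega)
    have w5 := multSeq_ne_zero hK (2 * b + d + 5) (by omega) (by omega)
    have w4 := multSeq_ne_zero hK (2 * b + d + 4) (by omega) (by omega)
    simp only [show b + 2 + (d + 1) = b + d + 3 by ring, show b + 1 + (d + 2) = b + d + 3 by ring,
      show 2 * (b + 2) + (d + 1) = 2 * b + d + 5 by ring,
      show 2 * (b + 1) + (d + 2) = 2 * b + d + 4 by ring,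
      show 2 * b + d + 4 + 2 = 2 * b + d + 6 by ring, show b + 3 + d = b + d + 3 by ring,
      show 2 * b + d + 4 + 1 = 2 * b + d + 5 by ring, show b + 1 + 2 = b + 3 by ring,
      show 2 * (b + 3) + d = 2 * b + d + 6 by ring, show b + 1 + 1 = b + 2 by ring] at *
    have hne : xCoord ((b + d + 3) • P) ≠ xCoord ((b + 2) • P) := by
      intro h
      rw [h, sub_self, zero_mul, zero_mul] at i1
      exact mul_ne_zero w5 wd1 i1.symm
    have key1 := xCoord_add_sub (hK (b + d + 3) (by omega) (by omega))
      (hK (b + 2) (by omega) (by omega)) hne (xCoord P)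
    -- Both identities evaluate the same symmetric form at (b+2)P, P and (b+d+3)P; comparing them
    -- relates the sought difference to the two from the induction hypothesis.
    have key2 := xCoord_add_sub (hK (b + 2) (by omega) (by omega)) h1
      (xCoord_nsmul_ne hK (k := b + 2) (by omega) (by omega)).symm (xCoord ((b + d + 3) • P))
    rw [← tripleForm_rotate, ← key1, ← add_nsmul, ← succ_nsmul,
      show (b + 2) • P - P = (b + 1) • P by rw [succ_nsmul _ (b + 1)]; abel,
      show (b + d + 3) • P - (b + 2) • P = (d + 1) • P by
        rw [sub_eq_iff_eq_add, ← add_nsmul]; congr 1; ring,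
      show b + d + 3 + (b + 2) = 2 * b + d + 5 by ring, show b + 2 + 1 = b + 3 by ring] at key2
    generalize xCoord ((2 * b + d + 5) • P) = Xs, xCoord ((d + 1) • P) = Xd,
      xCoord ((b + d + 3) • P) = Xa, xCoord ((b + 1) • P) = X₁, xCoord ((b + 2) • P) = X₂,
      xCoord ((b + 3) • P) = X₃, xCoord P = x, multSeq P d = u₀, multSeq P (d + 1) = u₁,
      multSeq P (d + 2) = u₂, multSeq P (2 * b + d + 4) = v₄, multSeq P (2 * b + d + 5) = v₅,
      multSeq P (2 * b + d + 6) = v₆, multSeq P (b + d + 3) = wa, multSeq P (b + 1) = w₁,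
      multSeq P (b + 2) = w₂, multSeq P (b + 3) = w₃ at *
    apply mul_left_cancel₀ (mul_ne_zero (mul_ne_zero w4 wd2)
      (mul_ne_zero (pow_ne_zero 2 w5) (pow_ne_zero 2 wd1)))
    linear_combination -(X₃ - Xa) * wa ^ 2 * v₅ ^ 2 * u₁ ^ 2 * w₃ ^ 2 * i2
      - (X₃ - Xa) * wa ^ 4 * v₅ ^ 2 * u₁ ^ 2 * (X₁ - Xa) * ((x - X₂) * w₂ ^ 2 + w₃ * w₁) * sb
      + v₅ ^ 2 * u₁ ^ 2 * wa ^ 4 * w₂ ^ 4 * key2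
      + (x - Xd) * u₁ ^ 2 * ((X₂ - Xa) * wa ^ 2 * w₂ ^ 2) ^ 2 * ss
      + v₆ * v₄ * ((X₂ - Xa) * wa ^ 2 * w₂ ^ 2) ^ 2 * sd
      + v₆ * v₄ * u₂ * u₀ * ((X₂ - Xa) * wa ^ 2 * w₂ ^ 2 + v₅ * u₁) * i1

end DivisionValues

end

section

open WeierstrassCurve WeierstrassCurve.Affine Polynomial

/-! ### Identification of the sequence with values of division polynomials. -/

section DivisionValues

variable {F : Type*} [Field F] {W : WeierstrassCurve.Affine F}

lemma eval_Ψ₃ (x : F) : W.Ψ₃.eval x =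
    3 * x ^ 4 + W.b₂ * x ^ 3 + 3 * W.b₄ * x ^ 2 + 3 * W.b₆ * x + W.b₈ := by
  simp [Ψ₃]

lemma eval_Ψ₂Sq (x : F) : W.Ψ₂Sq.eval x =
    4 * x ^ 3 + W.b₂ * x ^ 2 + 2 * W.b₄ * x + W.b₆ := by
  simp [Ψ₂Sq]

lemma eval_preΨ₄ (x : F) : W.preΨ₄.eval x =
    2 * x ^ 6 + W.b₂ * x ^ 5 + 5 * W.b₄ * x ^ 4 + 10 * W.b₆ * x ^ 3 + 10 * W.b₈ * x ^ 2 +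
      (W.b₂ * W.b₈ - W.b₄ * W.b₆) * x + (W.b₄ * W.b₈ - W.b₆ ^ 2) := by
  simp [preΨ₄]

lemma eval_preΨ₄_add (x : F) : W.preΨ₄.eval x + W.Ψ₂Sq.eval x ^ 2 =
    W.Ψ₃.eval x * (6 * x ^ 2 + W.b₂ * x + W.b₄) := by
  rw [eval_preΨ₄, eval_Ψ₂Sq, eval_Ψ₃]
  linear_combination x ^ 2 * W.b_relation

lemma psiValue_even (P : W.Point) (m : ℤ) : psiValue P (2 * m) * etaCoord P =
    psiValue P (m - 1) ^ 2 * psiValue P m * psiValue P (m + 2) -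
      psiValue P (m - 2) * psiValue P m * psiValue P (m + 1) ^ 2 :=
  normEDS_even _ _ _ m

lemma psiValue_odd (P : W.Point) (m : ℤ) : psiValue P (2 * m + 1) =
    psiValue P (m + 2) * psiValue P m ^ 3 - psiValue P (m - 1) * psiValue P (m + 1) ^ 3 :=
  normEDS_odd _ _ _ m

variable [DecidableEq F] {P : W.Point} {K : ℕ}

lemma multSeq_three (h2 : 2 • P ≠ 0) : multSeq P 3 = W.Ψ₃.eval (xCoord P) := by
  have hP : P ≠ 0 := by rintro rfl; simp at h2
  have hd := xCoord_two_nsmul h2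
  have := etaCoord_sq hP
  simp only [multSeq, zero_add, div_one, eval_Ψ₃]
  linear_combination xCoord P * this - hd

lemma multSeq_four (h2 : 2 • P ≠ 0) (h3 : 3 • P ≠ 0) :
    multSeq P 4 = W.preΨ₄.eval (xCoord P) * etaCoord P := by
  have hP : P ≠ 0 := by rintro rfl; simp at h2
  have hη := mt (etaCoord_eq_zero_iff hP).1 h2
  have hd := xCoord_two_nsmul h2
  have hs := etaCoord_sq hP
  have hne : xCoord (2 • P) ≠ xCoord P := by
    intro h
    rcases (xCoord_eq_iff h2 hP).1 h with h | h
    · exact hP (by rwa [two_nsmul, add_eq_left] at h)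
    · exact h3 (by rw [succ_nsmul, h, neg_add_cancel])
  -- Subtracting the instances z = 0 and z = 1 isolates the sum x(3P) + x(P).
  have t0 := xCoord_add_sub h2 hP hne 0
  have t1 := xCoord_add_sub h2 hP hne 1
  rw [← succ_nsmul, show 2 • P - P = P by rw [two_nsmul]; abel] at t0 t1
  have h3' := multSeq_three h2
  have hq := eval_preΨ₄_add (W := W) (xCoord P)
  rw [eval_Ψ₂Sq, ← hs] at hq
  have hstep : multSeq P 4 * etaCoord P = (xCoord P - xCoord (3 • P)) * multSeq P 3 ^ 2 := by
    rw [multSeq]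
    simp only [multSeq, zero_add]
    field_simp
  apply mul_right_cancel₀ hη
  rw [hstep, h3']
  have hΨ : W.Ψ₃.eval (xCoord P) = (xCoord P - xCoord (2 • P)) * etaCoord P ^ 2 := by
    rw [← h3']; simp [multSeq]
  rw [eq_sub_of_add_eq hq, hΨ]
  simp only [tripleForm] at t0 t1
  linear_combination etaCoord P ^ 4 * (t1 - t0 + hs)

/-- The cases d = 2 and d = 1 of `xCoord_sub_mul_multSeq_sq` are the even and odd recursions that
determine `normEDS` from its first terms. -/
lemma multSeq_eq_psiValue (hK : ∀ k, 1 ≤ k → k ≤ K → k • P ≠ 0) (h3 : 3 ≤ K) (n : ℕ)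
    (hn : n ≤ K + 1) : multSeq P n = psiValue P n := by
  have h1 : P ≠ 0 := by simpa using hK 1 le_rfl (by omega)
  have hη := mt (etaCoord_eq_zero_iff h1).1 (hK 2 (by omega) (by omega))
  induction n using Nat.strong_induction_on with
  | _ n ih =>
  obtain hn4 | hn5 := Nat.lt_or_ge n 5
  · interval_cases n
    · simp [multSeq, psiValue]
    · simp [multSeq, psiValue]
    · simp [multSeq, psiValue]
    · simp [multSeq_three (hK 2 (by omega) (by omega)), psiValue]
    · simp [multSeq_four (hK 2 (by omega) (by omega)) (hK 3 (by omega) (by omega)), psiValue]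
  obtain ⟨m, rfl | rfl⟩ := Nat.even_or_odd' n
  · obtain ⟨m, rfl⟩ : ∃ k, m = k + 3 := ⟨m - 3, by omega⟩
    have h := xCoord_sub_mul_multSeq_sq hK (m + 2) 2 (by omega) (by omega) (by omega)
    have s1 := multSeq_step hK (n := m + 1) (by omega)
    have s2 := multSeq_step hK (n := m + 3) (by omega)
    have e := psiValue_even P (m + 3)
    rw [show (m + 3 - 1 : ℤ) = (m + 2 : ℕ) by push_cast; ring,
      show (m + 3 - 2 : ℤ) = (m + 1 : ℕ) by push_cast; ring,
      show (m + 3 + 2 : ℤ) = (m + 5 : ℕ) by push_cast; ring,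
      show (m + 3 + 1 : ℤ) = (m + 4 : ℕ) by push_cast; ring,
      show (2 * (m + 3) : ℤ) = (2 * (m + 3) : ℕ) by push_cast; ring,
      show (m + 3 : ℤ) = (m + 3 : ℕ) by push_cast; ring,
      ← ih (m + 1) (by omega) (by omega), ← ih (m + 2) (by omega) (by omega),
      ← ih (m + 3) (by omega) (by omega), ← ih (m + 4) (by omega) (by omega),
      ← ih (m + 5) (by omega) (by omega)] at e
    simp only [show m + 3 + 1 = m + 4 by ring, show m + 3 + 2 = m + 5 by ring,
      show m + 1 + 2 = m + 3 by ring, show m + 1 + 1 = m + 2 by ring,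
      show 2 * (m + 2) + 2 = 2 * (m + 3) by ring] at h s1 s2
    change _ = _ * etaCoord P at h
    apply mul_right_cancel₀ hη
    linear_combination -e - h + multSeq P (m + 2) ^ 2 * s2 - multSeq P (m + 4) ^ 2 * s1
  · obtain ⟨m, rfl⟩ : ∃ k, m = k + 2 := ⟨m - 2, by omega⟩
    have h := xCoord_sub_mul_multSeq_sq hK (m + 2) 1 (by omega) (by omega) (by omega)
    have s1 := multSeq_step hK (n := m + 1) (by omega)
    have s2 := multSeq_step hK (n := m + 2) (by omega)
    have e := psiValue_odd P (m + 2)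
    rw [show (m + 2 - 1 : ℤ) = (m + 1 : ℕ) by push_cast; ring,
      show (m + 2 + 2 : ℤ) = (m + 4 : ℕ) by push_cast; ring,
      show (m + 2 + 1 : ℤ) = (m + 3 : ℕ) by push_cast; ring,
      show (2 * (m + 2) + 1 : ℤ) = (2 * (m + 2) + 1 : ℕ) by push_cast; ring,
      show (m + 2 : ℤ) = (m + 2 : ℕ) by push_cast; ring,
      ← ih (m + 1) (by omega) (by omega), ← ih (m + 2) (by omega) (by omega),
      ← ih (m + 3) (by omega) (by omega), ← ih (m + 4) (by omega) (by omega)] at e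
    simp only [show m + 1 + 1 = m + 2 by ring, show m + 1 + 2 = m + 3 by ring,
      show m + 2 + 2 = m + 4 by ring] at h s1 s2
    rw [show multSeq P 1 = 1 from rfl] at h
    linear_combination -e - h + multSeq P (m + 2) ^ 2 * s2 - multSeq P (m + 3) ^ 2 * s1

end DivisionValues

end

section

open WeierstrassCurve WeierstrassCurve.Affine Polynomial

/-! ### Zeros of division polynomials are torsion points. -/

section DivisionValues

variable {F : Type*} [Field F] {W : WeierstrassCurve.Affine F}

/-- The squared quantity is half the derivative of Ψ₂Sq, so a common zero of Ψ₂Sq and Ψ₃ would be a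
double root of Ψ₂Sq, which nonsingularity forbids. -/
lemma four_mul_eval_Ψ₃_add (x : F) : 4 * W.Ψ₃.eval x + (6 * x ^ 2 + W.b₂ * x + W.b₄) ^ 2 =
    W.Ψ₂Sq.eval x * (12 * x + W.b₂) := by
  rw [eval_Ψ₂Sq, eval_Ψ₃]
  linear_combination W.b_relation

lemma psiValue_eq {P : W.Point} (hP : P ≠ 0) (n : ℤ) :
    psiValue P n = (W.preΨ n).eval (xCoord P) * if Even n then etaCoord P else 1 := by
  have h := (etaCoord_sq hP).trans (eval_Ψ₂Sq _).symm
  have : (W.preΨ n).eval (xCoord P) = preNormEDS (etaCoord P ^ 4)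
      (W.Ψ₃.eval (xCoord P)) (W.preΨ₄.eval (xCoord P)) n := by
    rw [preΨ, ← coe_evalRingHom, map_preNormEDS, map_pow, coe_evalRingHom, ← h]
    ring_nf
  rw [psiValue, normEDS, this]

lemma psiValue_two_mul_add {P : W.Point} (hP : P ≠ 0) {b d : ℕ} :
    psiValue P (2 * b + d : ℕ) * psiValue P d = (W.preΨ (2 * b + d : ℕ) * W.preΨ d *
      if Even d then W.Ψ₂Sq else 1).eval (xCoord P) := by
  have h := (etaCoord_sq hP).trans (eval_Ψ₂Sq _).symm
  rw [psiValue_eq hP, psiValue_eq hP]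
  by_cases hd : Even d <;> simp [hd, parity_simps, ← h]
  ring

lemma psiValue_sq {P : W.Point} (hP : P ≠ 0) (n : ℕ) : psiValue P n ^ 2 = (W.ΨSq n).eval (xCoord P) := by
  have h := (etaCoord_sq hP).trans (eval_Ψ₂Sq _).symm
  rw [psiValue_eq hP, ΨSq]
  by_cases hd : Even n <;> simp [hd, ← h]
  ring

lemma psiValue_add_one_mul_sub_one {P : W.Point} (hP : P ≠ 0) {n : ℕ} (hn : 1 ≤ n) :
    psiValue P (n + 1 : ℕ) * psiValue P (n - 1 : ℕ) = (W.preΨ (n + 1 : ℕ) * W.preΨ (n - 1 : ℕ) *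
      if Even n then 1 else W.Ψ₂Sq).eval (xCoord P) := by
  have h := (etaCoord_sq hP).trans (eval_Ψ₂Sq _).symm
  obtain ⟨n, rfl⟩ : ∃ k, n = k + 1 := ⟨n - 1, by omega⟩
  rw [psiValue_eq hP, psiValue_eq hP]
  by_cases hd : Even n <;> simp [hd, parity_simps, ← h]
  ring

lemma exists_point_xCoord [IsAlgClosed F] (W : WeierstrassCurve.Affine F) [W.IsElliptic] (x : F) :
    ∃ P : W.Point, P ≠ 0 ∧ xCoord P = x := by
  obtain ⟨y, hy⟩ := IsAlgClosed.exists_eval₂_eq_zero (RingHom.id F)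
    (C 1 * X ^ 2 + C (W.a₁ * x + W.a₃) * X + C (-(x ^ 3 + W.a₂ * x ^ 2 + W.a₄ * x + W.a₆)))
    (by rw [degree_quadratic one_ne_zero]; decide)
  have h : W.Equation x y := by
    rw [equation_iff]
    simp at hy
    linear_combination hy
  exact ⟨.some x y (equation_iff_nonsingular.1 h), Point.some_ne_zero _, rfl⟩

variable [DecidableEq F] {P : W.Point} {K : ℕ}

lemma psiValue_add_mul_sub (hK : ∀ k, 1 ≤ k → k ≤ K → k • P ≠ 0) (h3 : 3 ≤ K) {b d : ℕ}
    (hb : 1 ≤ b) (hd : 1 ≤ d) (hbd : 2 * b + d ≤ K + 1) :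
    psiValue P (2 * b + d : ℕ) * psiValue P d =
      psiValue P (b + d + 1 : ℕ) * psiValue P (b + d - 1 : ℕ) * psiValue P b ^ 2 -
        psiValue P (b + 1 : ℕ) * psiValue P (b - 1 : ℕ) * psiValue P (b + d : ℕ) ^ 2 := by
  have e := multSeq_eq_psiValue hK h3
  rw [← e _ (by omega), ← e _ (by omega), ← e _ (by omega), ← e _ (by omega), ← e _ (by omega),
    ← e _ (by omega), ← e _ (by omega), ← e _ (by omega)]
  have h := xCoord_sub_mul_multSeq_sq hK b d hb hd hbd
  obtain ⟨b, rfl⟩ : ∃ k, b = k + 1 := ⟨b - 1, by omega⟩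
  have s1 := multSeq_step hK (n := b) (by omega)
  have s2 := multSeq_step hK (n := b + d) (by omega)
  simp only [show b + 1 + d = b + d + 1 by ring, show b + d + 1 + 1 = b + d + 2 by ring,
    show b + 1 + 1 = b + 2 by ring, Nat.add_sub_cancel] at *
  linear_combination -h - multSeq P (b + d + 1) ^ 2 * s1 + multSeq P (b + 1) ^ 2 * s2

lemma psiValue_eq_zero_of_first {n : ℕ} (hn : 2 ≤ n) (hK : ∀ k, 1 ≤ k → k < n → k • P ≠ 0)
    (h0 : n • P = 0) : psiValue P n = 0 := by
  have h1 : P ≠ 0 := by simpa using hK 1 le_rfl (by omega)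
  obtain rfl | ⟨n, rfl⟩ : n = 2 ∨ ∃ k, n = k + 3 :=
    if h : n = 2 then .inl h else .inr ⟨n - 3, by omega⟩
  · simpa [psiValue] using (etaCoord_eq_zero_iff h1).2 h0
  · have hX : xCoord ((n + 2) • P) = xCoord P := by
      rw [xCoord_eq_iff (hK _ (by omega) (by omega)) h1]
      exact .inr (eq_neg_of_add_eq_zero_left (by rwa [← succ_nsmul]))
    have hw : multSeq P (n + 3) = 0 := by rw [multSeq, hX]; simp
    obtain rfl | hn0 := Nat.eq_zero_or_pos n
    · rw [multSeq_three (hK 2 (by omega) (by omega))] at hw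
      simpa [psiValue] using hw
    · rwa [multSeq_eq_psiValue (K := n + 2) (fun k h h' => hK k h (by omega)) (by omega) _ le_rfl]
        at hw

lemma nsmul_ne_zero_of_psiValue_ne_zero (hP : P ≠ 0)
    (h : ∀ k : ℕ, 1 ≤ k → k ≤ K → psiValue P k ≠ 0) : ∀ k, 1 ≤ k → k ≤ K → k • P ≠ 0 := by
  intro n
  induction n using Nat.strong_induction_on with
  | _ n ih =>
  intro h1 hn h0
  obtain rfl | h2 : n = 1 ∨ 2 ≤ n := by omega
  · exact hP (by simpa using h0)
  · exact h n h1 hn (psiValue_eq_zero_of_first h2 (fun k hk hk' => ih k hk' hk (by omega)) h0)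

variable [IsAlgClosed F] [CharZero F]

/-- The elliptic relation between division polynomials. -/
lemma preΨ_add_mul_sub (W : WeierstrassCurve.Affine F) [W.IsElliptic] {b d : ℕ}
    (hb : 1 ≤ b) (hd : 1 ≤ d) :
    (W.preΨ (2 * b + d : ℕ) * W.preΨ d * if Even d then W.Ψ₂Sq else 1) =
      (W.preΨ (b + d + 1 : ℕ) * W.preΨ (b + d - 1 : ℕ) * if Even (b + d) then 1 else W.Ψ₂Sq) *
        W.ΨSq b - (W.preΨ (b + 1 : ℕ) * W.preΨ (b - 1 : ℕ) * if Even b then 1 else W.Ψ₂Sq) *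
        W.ΨSq (b + d : ℕ) := by
  -- After multiplication by this nonzero polynomial the identity needs checking only at x where no
  -- ψ_k with k ≤ 2b + d vanishes; there all these multiples of the point are nonzero and the
  -- pointwise relation applies.
  have hprod : (∏ k ∈ Finset.Icc 1 (2 * b + d), W.ΨSq (k : ℕ)) ≠ 0 :=
    Finset.prod_ne_zero_iff.2 fun k hk => W.ΨSq_ne_zero <| by
      have := (Finset.mem_Icc.1 hk).1
      exact_mod_cast (by omega : k ≠ 0)
  refine mul_right_cancel₀ hprod (Polynomial.funext fun x => ?_)
  by_cases hx : (∏ k ∈ Finset.Icc 1 (2 * b + d), W.ΨSq (k : ℕ)).eval x = 0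
  · rw [eval_mul (p := _ * _), hx, eval_mul (p := _ - _), hx, mul_zero, mul_zero]
  obtain ⟨P, hP, rfl⟩ := exists_point_xCoord W x
  rw [eval_prod, Finset.prod_eq_zero_iff] at hx
  push Not at hx
  have hK : ∀ k, 1 ≤ k → k ≤ 2 * b + d → k • P ≠ 0 :=
    nsmul_ne_zero_of_psiValue_ne_zero hP fun k h1 h2 h0 => hx k (Finset.mem_Icc.2 ⟨h1, h2⟩) <| by
      rw [← psiValue_sq hP, h0, zero_pow two_ne_zero]
  have h := psiValue_add_mul_sub hK (by omega) hb hd (by omega)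
  rw [psiValue_two_mul_add hP, psiValue_add_one_mul_sub_one hP (by omega),
    psiValue_add_one_mul_sub_one hP hb, psiValue_sq hP, psiValue_sq hP, ← eval_mul, ← eval_mul,
    ← eval_sub] at h
  rw [eval_mul, h, eval_mul]

variable [W.IsElliptic]

lemma psiValue_elliptic (hP : P ≠ 0) {b d : ℕ} (hb : 1 ≤ b) (hd : 1 ≤ d) :
    psiValue P (2 * b + d : ℕ) * psiValue P d =
      psiValue P (b + d + 1 : ℕ) * psiValue P (b + d - 1 : ℕ) * psiValue P b ^ 2 -
        psiValue P (b + 1 : ℕ) * psiValue P (b - 1 : ℕ) * psiValue P (b + d : ℕ) ^ 2 := by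
  rw [psiValue_two_mul_add hP, psiValue_add_one_mul_sub_one hP (by omega),
    psiValue_add_one_mul_sub_one hP hb, psiValue_sq hP, psiValue_sq hP,
    preΨ_add_mul_sub W hb hd, eval_sub, eval_mul (p := _ * _), eval_mul (q := W.ΨSq _)]

omit [DecidableEq F] [IsAlgClosed F] [W.IsElliptic] in
lemma psiValue_three_ne_zero (hP : P ≠ 0) (h2 : etaCoord P = 0) : psiValue P 3 ≠ 0 := by
  intro h3
  have e := four_mul_eval_Ψ₃_add (W := W) (xCoord P)
  rw [psiValue_eq hP, if_neg (by decide), mul_one, preΨ_three] at h3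
  rw [h3, eval_Ψ₂Sq, ← etaCoord_sq hP, h2] at e
  have e : 6 * xCoord P ^ 2 + W.b₂ * xCoord P + W.b₄ = 0 := by simpa using e
  obtain ⟨x, y, h, rfl⟩ := exists_eq_some hP
  simp only [etaCoord_some, xCoord_some, b₂, b₄] at h2 e
  rcases ((W.nonsingular_iff' x y).1 h).2 with h | h
  · apply h
    apply mul_left_cancel₀ (two_ne_zero (α := F))
    linear_combination -e + W.a₁ * h2
  · exact h h2

/-- The zeros of the `n`-division polynomial are points killed by `n`. -/
theorem nsmul_eq_zero_of_psiValue_eq_zero (hP : P ≠ 0) {n : ℕ} (hn : 1 ≤ n)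
    (h : psiValue P n = 0) : n • P = 0 := by
  classical
  -- The first zero index r is the order of P, and r divides every zero index.
  have hex : ∃ r : ℕ, 1 ≤ r ∧ psiValue P r = 0 := ⟨n, hn, h⟩
  obtain ⟨r, ⟨hr1, hr0⟩, hmin⟩ : ∃ r : ℕ, (1 ≤ r ∧ psiValue P r = 0) ∧
      ∀ k < r, 1 ≤ k → psiValue P k ≠ 0 :=
    ⟨Nat.find hex, Nat.find_spec hex, fun k hk h1 h0 => Nat.find_min hex hk ⟨h1, h0⟩⟩
  have hr2 : 2 ≤ r := by
    by_contra hlt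
    obtain rfl : r = 1 := by omega
    simp [psiValue] at hr0
  have hlt : ∀ k, 1 ≤ k → k < r → k • P ≠ 0 := fun k h1 h2 =>
    nsmul_ne_zero_of_psiValue_ne_zero (K := r - 1) hP
      (fun k h1 h2 => hmin k (by omega) h1) k h1 (by omega)
  have hrP : r • P = 0 := by
    by_contra hne
    obtain rfl | h3 : r = 2 ∨ 3 ≤ r := by omega
    · exact hne ((etaCoord_eq_zero_iff hP).1 (by simpa [psiValue] using hr0))
    · have hK : ∀ k, 1 ≤ k → k ≤ r → k • P ≠ 0 := fun k h1 h2 => by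
        obtain rfl | h2 := h2.eq_or_lt
        exacts [hne, hlt k h1 h2]
      rw [← multSeq_eq_psiValue hK h3 r (by omega)] at hr0
      exact multSeq_ne_zero hK r hr1 le_rfl hr0
  have hpred : psiValue P (r - 1 : ℕ) ≠ 0 := hmin _ (by omega) (by omega)
  -- Two consecutive zeros are impossible. For r ≥ 4 the elliptic relation would leave ψ₃ ψ₁
  -- ψ_{r-1}² = 0.
  have hsucc : psiValue P (r + 1 : ℤ) ≠ 0 := by
    intro hs
    obtain rfl | rfl | h4 : r = 2 ∨ r = 3 ∨ 4 ≤ r := by omega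
    · exact psiValue_three_ne_zero hP (by simpa [psiValue] using hr0) hs
    · have e := eval_preΨ₄_add (W := W) (xCoord P)
      have h3 : W.Ψ₃.eval (xCoord P) = 0 := by simpa [psiValue] using hr0
      have h2 : etaCoord P ≠ 0 := by simpa [psiValue] using hmin 2 (by omega) (by omega)
      have h4 : W.preΨ₄.eval (xCoord P) = 0 := by simpa [psiValue, h2] using hs
      rw [h3, h4, eval_Ψ₂Sq, ← etaCoord_sq hP] at e
      simp [h2] at e
    · have e := psiValue_elliptic hP (b := 2) (d := r - 3) (by omega) (by omega)
      rw [show 2 * 2 + (r - 3) = r + 1 by omega, show 2 + (r - 3) + 1 = r by omega, Nat.cast_succ, hs, hr0,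
        show 2 + (r - 3) = r - 1 by omega] at e
      have h3 : psiValue P 3 ≠ 0 := hmin 3 (by omega) (by omega)
      have h1 : psiValue P 1 ≠ 0 := hmin 1 (by omega) (by omega)
      simp [h3, h1, hpred] at e
  -- Descent from m to m - r: with ψ_m = ψ_r = 0, the relation reduces to ψ_{r+1} ψ_{r-1} ψ_{m-r}² =
  -- 0.
  have hdvd : ∀ m : ℕ, 1 ≤ m → psiValue P m = 0 → r ∣ m := by
    intro m
    induction m using Nat.strong_induction_on with
    | _ m ih =>
    intro hm h0
    have hrm : r ≤ m := by
      by_contra hlt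
      exact hmin m (by omega) hm h0
    obtain rfl | hrm := hrm.eq_or_lt
    · rfl
    have hsub : psiValue P (m - r : ℕ) = 0 := by
      rcases lt_trichotomy m (2 * r) with h | rfl | h
      · have e := psiValue_elliptic hP (b := m - r) (d := 2 * r - m) (by omega) (by omega)
        rw [show 2 * (m - r) + (2 * r - m) = m by omega,
          show m - r + (2 * r - m) = r by omega, h0, hr0] at e
        simpa [hsucc, hpred] using e
      · rwa [show 2 * r - r = r by omega]
      · have e := psiValue_elliptic hP (b := r) (d := m - 2 * r) (by omega) (by omega)
        rw [show 2 * r + (m - 2 * r) = m by omega,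
          show r + (m - 2 * r) = m - r by omega, h0, hr0] at e
        simpa [hsucc, hpred] using e
    have := ih (m - r) (by omega) (by omega) hsub
    exact (Nat.dvd_sub_iff_left hrm.le dvd_rfl).1 this
  obtain ⟨k, rfl⟩ := hdvd n hn h
  rw [mul_comm, mul_nsmul', hrP, nsmul_zero]

end DivisionValues

end

section

open WeierstrassCurve WeierstrassCurve.Affine Polynomial

/-! ### A square root of ±n generated by n-torsion, for odd n. -/

section QuadraticSubfield

/-- These are the parameters at a point of order two. With first parameter 0, the odd recursion
keeps one of its two terms, whose factors again have odd index, so d never enters. -/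
lemma preNormEDS_zero_odd {R : Type*} [CommRing R] (D d : R) (k : ℕ) :
    preNormEDS 0 (-D ^ 2) d (2 * k + 1) = (-1) ^ k * D ^ (k * (k + 1)) := by
  induction k using Nat.strong_induction_on with
  | _ k ih =>
  obtain rfl | rfl | hk : k = 0 ∨ k = 1 ∨ 2 ≤ k := by omega
  · simp
  · norm_num
  rw [preNormEDS_odd]
  obtain ⟨l, rfl | rfl⟩ := Nat.even_or_odd' k
  · obtain ⟨l, rfl⟩ : ∃ j, l = j + 1 := ⟨l - 1, by omega⟩
    have i1 := ih l (by omega)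
    have i2 := ih (l + 1) (by omega)
    rw [show ((2 * (l + 1) : ℕ) : ℤ) - 1 = 2 * l + 1 by push_cast; ring, i1]
    rw [show ((2 * (l + 1) : ℕ) : ℤ) + 1 = 2 * (l + 1 : ℕ) + 1 by push_cast; ring, i2]
    simp only [even_two.mul_right, Nat.cast_mul, Nat.cast_ofNat, if_true, mul_zero, zero_sub, mul_one,
      Even.neg_pow, one_pow, one_mul]
    rw [mul_pow, ← pow_mul, ← pow_mul]
    have : (-1 : R) ^ l * (-1) ^ ((l + 1) * 3) = -1 := by
      rw [← pow_add, show l + (l + 1) * 3 = 2 * (2 * l + 1) + 1 by ring, pow_succ, pow_mul]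
      simp
    rw [show 2 * (l + 1) * (2 * (l + 1) + 1) = l * (l + 1) + (l + 1) * (l + 1 + 1) * 3 by ring,
      pow_add]
    linear_combination -D ^ (l * (l + 1)) * D ^ ((l + 1) * (l + 1 + 1) * 3) * this
  · have i1 := ih l (by omega)
    have i2 := ih (l + 1) (by omega)
    rw [show ((2 * l + 1 : ℕ) : ℤ) + 2 = 2 * (l + 1 : ℕ) + 1 by push_cast; ring, i2,
      show ((2 * l + 1 : ℕ) : ℤ) = 2 * l + 1 by push_cast; ring, i1]
    simp only [show ¬Even (2 * l + 1 : ℤ) by simp [parity_simps], if_false, mul_zero, sub_zero,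
      mul_one]
    rw [mul_pow, ← pow_mul, ← pow_mul]
    have : (-1 : R) ^ (l + 1) * (-1) ^ (l * 3) = (-1) ^ (2 * l + 1) := by
      rw [← pow_add, show l + 1 + l * 3 = (2 * l + 1) + 2 * l by ring, pow_add _ _ (2 * l), pow_mul]
      simp
    rw [show (2 * l + 1) * (2 * l + 1 + 1) = (l + 1) * (l + 1 + 1) + l * (l + 1) * 3 by ring,
      pow_add _ ((l + 1) * (l + 1 + 1))]
    linear_combination D ^ ((l + 1) * (l + 1 + 1)) * D ^ (l * (l + 1) * 3) * this

variable {F : Type*} [Field F]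

/-- The numbers `e₁`, `e₂`, `e₃` are the `x`-coordinates of the points of order two. -/
def IsTwoTorsionRoots (W : WeierstrassCurve.Affine F) (e₁ e₂ e₃ : F) : Prop :=
  W.b₂ = -4 * (e₁ + e₂ + e₃) ∧ W.b₄ = 2 * (e₁ * e₂ + e₁ * e₃ + e₂ * e₃) ∧
    W.b₆ = -4 * (e₁ * e₂ * e₃)

lemma exists_isTwoTorsionRoots [CharZero F] [IsAlgClosed F] (W : WeierstrassCurve.Affine F) :
    ∃ e₁ e₂ e₃, IsTwoTorsionRoots W e₁ e₂ e₃ := by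
  obtain ⟨e₁, h₁⟩ := IsAlgClosed.exists_eval₂_eq_zero (RingHom.id F)
    (C 4 * X ^ 3 + C W.b₂ * X ^ 2 + C (2 * W.b₄) * X + C W.b₆)
    (by rw [degree_cubic (by norm_num)]; decide)
  obtain ⟨e₂, h₂⟩ := IsAlgClosed.exists_eval₂_eq_zero (RingHom.id F)
    (C 4 * X ^ 2 + C (W.b₂ + 4 * e₁) * X + C (2 * W.b₄ + (W.b₂ + 4 * e₁) * e₁))
    (by rw [degree_quadratic (by norm_num)]; decide)
  simp at h₁ h₂
  refine ⟨e₁, e₂, -W.b₂ / 4 - e₁ - e₂, ?_, ?_, ?_⟩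
  · ring
  · linear_combination h₂ / 2
  · linear_combination h₁ - e₁ * h₂

namespace IsTwoTorsionRoots

variable {W : WeierstrassCurve.Affine F} {e₁ e₂ e₃ : F} (h : IsTwoTorsionRoots W e₁ e₂ e₃)

include h

lemma rotate : IsTwoTorsionRoots W e₂ e₃ e₁ := by
  obtain ⟨h1, h2, h3⟩ := h
  exact ⟨by linear_combination h1, by linear_combination h2, by linear_combination h3⟩

lemma swap : IsTwoTorsionRoots W e₁ e₃ e₂ := by
  obtain ⟨h1, h2, h3⟩ := h
  exact ⟨by linear_combination h1, by linear_combination h2, by linear_combination h3⟩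

lemma eval_Ψ₂Sq (x : F) : W.Ψ₂Sq.eval x = 4 * ((x - e₁) * (x - e₂) * (x - e₃)) := by
  obtain ⟨h1, h2, h3⟩ := h
  rw [_root_.eval_Ψ₂Sq]
  linear_combination x ^ 2 * h1 + 2 * x * h2 + h3

variable [CharZero F]

lemma b₈ : W.b₈ = 4 * (e₁ + e₂ + e₃) * (e₁ * e₂ * e₃) - (e₁ * e₂ + e₁ * e₃ + e₂ * e₃) ^ 2 := by
  obtain ⟨h1, h2, h3⟩ := h
  have := W.b_relation
  rw [h1, h2, h3] at this
  linear_combination this / 4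

lemma eval_Ψ₃ : W.Ψ₃.eval e₁ = -((e₁ - e₂) * (e₁ - e₃)) ^ 2 := by
  have h8 := h.b₈
  obtain ⟨h1, h2, h3⟩ := h
  rw [_root_.eval_Ψ₃, h1, h2, h3, h8]
  ring

lemma Δ_eq : W.Δ = 16 * ((e₁ - e₂) * (e₁ - e₃) * (e₂ - e₃)) ^ 2 := by
  have h8 := h.b₈
  obtain ⟨h1, h2, h3⟩ := h
  rw [Δ, h8, h1, h2, h3]
  ring

lemma ne₁₂ [W.IsElliptic] : e₁ ≠ e₂ := by
  rintro rfl
  have := h.Δ_eq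
  rw [sub_self] at this
  exact W.isUnit_Δ.ne_zero (by simpa using this)

lemma ne₁₃ [W.IsElliptic] : e₁ ≠ e₃ := h.swap.ne₁₂

lemma ne₂₃ [W.IsElliptic] : e₂ ≠ e₃ := h.rotate.ne₁₂

lemma eval_preΨ_odd (k : ℕ) : (W.preΨ (2 * k + 1)).eval e₁ =
    (-1) ^ k * ((e₁ - e₂) * (e₁ - e₃)) ^ (k * (k + 1)) := by
  rw [preΨ, ← coe_evalRingHom, map_preNormEDS, map_pow, coe_evalRingHom, h.eval_Ψ₃, h.eval_Ψ₂Sq]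
  simp [preNormEDS_zero_odd]

end IsTwoTorsionRoots

/-- A field containing the coordinates of the points killed by an odd number `n` contains a square
root of `(-1) ^ ((n - 1) / 2) * n`. -/
theorem exists_sq_eq_of_etaCoord_mem [CharZero F] [DecidableEq F] [IsAlgClosed F]
    (W : WeierstrassCurve.Affine F) [W.IsElliptic] (M : Subfield F) (k : ℕ) (hΔ : W.Δ ∈ M)
    (hM : ∀ P : W.Point, P ≠ 0 → (2 * k + 1) • P = 0 → etaCoord P ∈ M) :
    ∃ z ∈ M, z ^ 2 = (-1) ^ k * (2 * k + 1) := by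
  obtain ⟨e₁, e₂, e₃, he⟩ := exists_isTwoTorsionRoots W
  choose pt hpt0 hptx using exists_point_xCoord W
  set f := W.preΨ (2 * k + 1 : ℕ) with hf
  have hn0 : ((2 * k + 1 : ℕ) : F) ≠ 0 := Nat.cast_ne_zero.2 (by omega)
  have hn0' : (((2 * k + 1 : ℕ) : ℤ) : F) ≠ 0 := by exact_mod_cast hn0
  have hf0 : f ≠ 0 := W.preΨ_ne_zero hn0'
  have hlead : f.leadingCoeff = (2 * k + 1 : ℕ) := by
    rw [hf, W.leadingCoeff_preΨ hn0']
    simp [parity_simps]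
  have hcard : f.roots.card = 2 * (k * (k + 1)) := by
    rw [← (IsAlgClosed.splits f).natDegree_eq_card_roots, hf, W.natDegree_preΨ hn0',
      if_neg (by simp [parity_simps]), Int.natAbs_natCast]
    refine Nat.div_eq_of_eq_mul_left two_pos ?_
    rw [show (2 * k + 1) ^ 2 = 2 * (k * (k + 1)) * 2 + 1 by ring, Nat.add_sub_cancel]
  have hfe : ∀ e, f.eval e = (2 * k + 1 : ℕ) * (f.roots.map fun r => e - r).prod := by
    intro e
    conv_lhs => rw [(IsAlgClosed.splits f).eq_prod_roots, hlead]
    simp [eval_multiset_prod, Multiset.map_map]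
  -- By η² = 4(x - e₁)(x - e₂)(x - e₃), H² is a power of 4 times f(e₁)f(e₂)f(e₃)/n³, where n = 2k +
  -- 1. The values f(eᵢ) are explicit, and their product is (-1)^k (Δ/16)^(k(k+1)).
  set H := (f.roots.map fun r => etaCoord (pt r)).prod with hH
  have hHM : H ∈ M := by
    refine Subfield.multiset_prod_mem _ _ fun a ha => ?_
    obtain ⟨r, hr, rfl⟩ := Multiset.mem_map.1 ha
    refine hM _ (hpt0 r) (nsmul_eq_zero_of_psiValue_eq_zero (hpt0 r) (by omega) ?_)
    rw [psiValue_eq (hpt0 r), hptx, ← hf, (mem_roots hf0).1 hr, zero_mul]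
  have hHsq : H ^ 2 = 4 ^ (2 * (k * (k + 1))) * ((f.roots.map fun r => e₁ - r).prod *
      (f.roots.map fun r => e₂ - r).prod * (f.roots.map fun r => e₃ - r).prod) := by
    rw [hH, ← Multiset.prod_map_pow, ← Multiset.prod_map_mul, ← Multiset.prod_map_mul,
      ← hcard]
    have : ∀ r, etaCoord (pt r) ^ 2 = -4 * ((e₁ - r) * (e₂ - r) * (e₃ - r)) := fun r => by
      rw [etaCoord_sq (hpt0 r), ← _root_.eval_Ψ₂Sq, he.eval_Ψ₂Sq, hptx]
      ring
    simp only [this]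
    rw [Multiset.prod_map_mul, Multiset.map_const', Multiset.prod_replicate, hcard,
      Even.neg_pow (even_two.mul_right _)]
  obtain ⟨m, hm⟩ : Even (k * (k + 1)) := Nat.even_mul_succ_self k
  have hΔ' := he.Δ_eq
  have hΔ0 : W.Δ ≠ 0 := W.isUnit_Δ.ne_zero
  have E₁ := (hfe e₁).symm.trans (he.eval_preΨ_odd k)
  have E₂ := (hfe e₂).symm.trans (he.rotate.eval_preΨ_odd k)
  have E₃ := (hfe e₃).symm.trans (he.rotate.rotate.eval_preΨ_odd k)
  -- As k(k+1) = 2m, the power of Δ/16 is a square in M; the factor n² turns n⁻³ into n.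
  refine ⟨(2 * k + 1 : ℕ) ^ 2 * H / (2 ^ (2 * (k * (k + 1))) * (W.Δ / 16) ^ m), ?_, ?_⟩
  · have h2 (a : ℕ) : (a : F) ∈ M := natCast_mem M a
    have h16 : (16 : F) ∈ M := h2 16
    have h2' : (2 : F) ∈ M := h2 2
    exact div_mem (mul_mem (pow_mem (h2 _) _) hHM)
      (mul_mem (pow_mem h2' _) (pow_mem (div_mem hΔ h16) _))
  · have hD : ((e₁ - e₂) * (e₁ - e₃)) * ((e₂ - e₃) * (e₂ - e₁)) * ((e₃ - e₁) * (e₃ - e₂)) =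
        -(W.Δ / 16) := by rw [hΔ']; ring
    have hD' : ((e₁ - e₂) * (e₁ - e₃)) ^ (m + m) * ((e₂ - e₃) * (e₂ - e₁)) ^ (m + m) *
        ((e₃ - e₁) * (e₃ - e₂)) ^ (m + m) = (W.Δ / 16) ^ (m + m) := by
      rw [← mul_pow, ← mul_pow, hD, Even.neg_pow ⟨m, rfl⟩]
    rw [hm] at E₁ E₂ E₃
    have hs : ((-1 : F) ^ k) ^ 2 = 1 := by rw [← pow_mul, mul_comm, pow_mul]; simp
    have hc : ((2 * k + 1 : ℕ) : F) = 2 * k + 1 := by push_cast; ring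
    rw [← two_mul, mul_comm 2 m, pow_mul (W.Δ / 16)] at hD'
    rw [← hc, div_pow, mul_pow, mul_pow, hHsq, show (4 : F) = 2 ^ 2 by norm_num, ← pow_mul (2 : F),
      mul_comm 2 (2 * _), pow_mul (2 : F), div_eq_iff (mul_ne_zero (pow_ne_zero 2 (pow_ne_zero _ two_ne_zero))
      (pow_ne_zero 2 (pow_ne_zero m (div_ne_zero hΔ0 (by norm_num)))))]
    rw [← two_mul, mul_comm 2 m] at E₁ E₂ E₃
    generalize ((2 * k + 1 : ℕ) : F) = n, (f.roots.map fun r => e₁ - r).prod = a₁,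
      (f.roots.map fun r => e₂ - r).prod = a₂, (f.roots.map fun r => e₃ - r).prod = a₃,
      ((2 : F) ^ (2 * (k * (k + 1)))) ^ 2 = T, (-1 : F) ^ k = s at *
    linear_combination T * n * (n * a₂ * (n * a₃) * E₁ +
      s * ((e₁ - e₂) * (e₁ - e₃)) ^ (m * 2) * (n * a₃) * E₂ + s * ((e₁ - e₂) * (e₁ - e₃)) ^ (m * 2) *
      (s * ((e₂ - e₃) * (e₂ - e₁)) ^ (m * 2)) * E₃ + s ^ 3 * hD' + s * ((W.Δ / 16) ^ m) ^ 2 * hs)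

end QuadraticSubfield

end

section

open Polynomial

/-! ### Squares modulo N. -/

section Squares

lemma isSquare_intCast_zmod_iff {n : ℕ} {u : ℤ} :
    IsSquare (u : ZMod n) ↔ ∃ v : ℤ, (n : ℤ) ∣ u - v ^ 2 := by
  constructor
  · rintro ⟨r, hr⟩
    obtain ⟨v, rfl⟩ := ZMod.intCast_surjective r
    exact ⟨v, (ZMod.intCast_eq_intCast_iff_dvd_sub _ _ n).1 (by push_cast; rw [hr, sq])⟩
  · rintro ⟨v, hv⟩
    refine ⟨(v : ZMod n), ?_⟩
    have := (ZMod.intCast_eq_intCast_iff_dvd_sub _ _ n).2 hv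
    rw [← this]; push_cast; ring

lemma isSquare_zmod_odd_prime_pow {p : ℕ} (hp : p.Prime) (hp2 : p ≠ 2) {u : ℤ}
    (hu : ¬ (p : ℤ) ∣ u) (hs : IsSquare (u : ZMod p)) (k : ℕ) :
    IsSquare (u : ZMod (p ^ (k + 1))) := by
  induction k with
  | zero =>
    rw [isSquare_intCast_zmod_iff] at hs ⊢
    simpa using hs
  | succ k ih =>
    rw [isSquare_intCast_zmod_iff] at ih ⊢
    obtain ⟨v, w, hw⟩ := ih
    have hpi : Prime (p : ℤ) := Nat.prime_iff_prime_int.1 hp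
    have h2v : IsCoprime (2 * v) (p : ℤ) := by
      refine ((Prime.coprime_iff_not_dvd hpi).2 fun h => ?_).symm
      rcases hpi.dvd_or_dvd h with h | h
      · exact hp2 ((Nat.prime_dvd_prime_iff_eq hp Nat.prime_two).1 (by exact_mod_cast h))
      · refine hu ?_
        rw [show u = (p ^ (k + 1) : ℕ) * w + v ^ 2 by linear_combination hw]
        push_cast
        exact dvd_add (Dvd.dvd.mul_right (dvd_pow_self _ (by omega)) _)
          (dvd_pow h two_ne_zero)
    obtain ⟨a, b, hab⟩ := h2v
    -- Hensel step: a inverts 2v modulo p, so the correction cancels the error w p^(k+1).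
    refine ⟨v + a * w * p ^ (k + 1), b * w - (a * w) ^ 2 * p ^ k, ?_⟩
    push_cast at hw ⊢
    linear_combination hw - (p : ℤ) ^ (k + 1) * w * hab

lemma isSquare_zmod_two_pow {u : ℤ} (k : ℕ) (hu : ((2 ^ k).gcd 8 : ℤ) ∣ u - 1) :
    IsSquare (u : ZMod (2 ^ k)) := by
  obtain hk | hk := Nat.lt_or_ge k 4
  · refine isSquare_intCast_zmod_iff.2 ⟨1, ?_⟩
    interval_cases k <;> simp_all
  obtain ⟨k, rfl⟩ : ∃ j, k = j + 3 := ⟨k - 3, by omega⟩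
  have h8 : (8 : ℤ) ∣ u - 1 := by
    rwa [Nat.gcd_eq_right (by rw [pow_add]; exact Dvd.intro_left _ rfl)] at hu
  clear hu hk
  induction k with
  | zero => exact isSquare_intCast_zmod_iff.2 ⟨1, by simpa using h8⟩
  | succ k ih =>
    rw [isSquare_intCast_zmod_iff] at ih ⊢
    obtain ⟨v, w, hw⟩ := ih
    push_cast at hw
    have hv : ¬ Even v := by
      rintro ⟨t, rfl⟩
      obtain ⟨s, hs⟩ := h8
      have : u = 2 * (2 ^ (k + 2) * w + 2 * t ^ 2) := by linear_combination hw
      omega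
    obtain ⟨t, ht⟩ := Int.not_even_iff_odd.1 hv
    obtain ⟨x, rfl | rfl⟩ := Int.even_or_odd' w
    · exact ⟨v, x, by push_cast; linear_combination hw⟩
    -- Since v is odd, this shift changes v² by 2^(k+3) modulo 2^(k+4), cancelling an odd error w.
    · refine ⟨v + 2 ^ (k + 2), x - t - 2 ^ k, ?_⟩
      push_cast
      linear_combination hw - 2 * 2 ^ (k + 2) * ht

/-- An integer coprime to `N` is a square modulo `N` if it is a square modulo each odd prime
divisor of `N` and congruent to `1` modulo `gcd N 8`. -/
lemma isSquare_zmod (N : ℕ) (hN : 0 < N) {u : ℤ}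
    (hp : ∀ p : ℕ, p.Prime → p ≠ 2 → p ∣ N → ¬ (p : ℤ) ∣ u ∧ IsSquare (u : ZMod p))
    (h8 : (N.gcd 8 : ℤ) ∣ u - 1) : IsSquare (u : ZMod N) := by
  induction N using Nat.recOnPosPrimePosCoprime with
  | zero => exact absurd hN (lt_irrefl 0)
  | one => exact ⟨0, Subsingleton.elim _ _⟩
  | prime_pow p k hpp hk =>
    obtain rfl | h2 := eq_or_ne p 2
    · exact isSquare_zmod_two_pow k h8
    · obtain ⟨k, rfl⟩ : ∃ j, k = j + 1 := ⟨k - 1, by omega⟩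
      have := hp p hpp h2 (dvd_pow_self p (by omega))
      exact isSquare_zmod_odd_prime_pow hpp h2 this.1 this.2 k
  | coprime a b ha hb hab iha ihb =>
    have sa := iha (by omega) (fun p h1 h2 h3 => hp p h1 h2 (h3.mul_right b))
      ((Int.natCast_dvd_natCast.2 (Nat.gcd_dvd_gcd_mul_right_left a 8 b)).trans h8)
    have sb := ihb (by omega) (fun p h1 h2 h3 => hp p h1 h2 (h3.mul_left a))
      ((Int.natCast_dvd_natCast.2 (Nat.gcd_dvd_gcd_mul_left_left b 8 a)).trans h8)
    obtain ⟨r, hr⟩ := sa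
    obtain ⟨s, hs⟩ := sb
    refine ⟨(ZMod.chineseRemainder hab).symm (r, s), ?_⟩
    rw [← map_mul, Prod.mk_mul_mk, ← hr, ← hs, eq_comm, RingEquiv.symm_apply_eq, map_intCast]
    rfl

end Squares

end

section

open Polynomial

/-! ### Quadratic Gauss sums and the Galois action. -/

section GaussSums

variable {L : Type*} [Field L] [CharZero L]

/-- The quadratic Gauss sum attached to a primitive `p`-th root of unity. -/
noncomputable def quadraticGaussSum (p : ℕ) [Fact p.Prime] {ζ : L} (hζ : ζ ^ p = 1) : L :=
  gaussSum ((quadraticChar (ZMod p)).ringHomComp (Int.castRingHom L)) (AddChar.zmodChar p hζ)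

lemma quadraticGaussSum_sq {k : ℕ} [Fact (2 * k + 1).Prime] {ζ : L}
    (hζ : IsPrimitiveRoot ζ (2 * k + 1)) :
    quadraticGaussSum (2 * k + 1) hζ.pow_eq_one ^ 2 = (-1) ^ k * (2 * k + 1) := by
  have h2 : ringChar (ZMod (2 * k + 1)) ≠ 2 := by rw [ZMod.ringChar_zmod_n]; omega
  have inj : Function.Injective (Int.castRingHom L) := Int.cast_injective
  have hχ : (quadraticChar (ZMod (2 * k + 1))).ringHomComp (Int.castRingHom L) ≠ 1 :=
    (MulChar.ringHomComp_ne_one_iff inj).2 (quadraticChar_ne_one h2)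
  have hq : ((quadraticChar (ZMod (2 * k + 1))).ringHomComp (Int.castRingHom L)).IsQuadratic :=
    (quadraticChar_isQuadratic _).comp _
  rw [quadraticGaussSum, gaussSum_sq hχ hq (AddChar.zmodChar_primitive_of_primitive_root _ hζ),
    MulChar.ringHomComp_apply, quadraticChar_neg_one h2, ZMod.card,
    ZMod.χ₄_eq_neg_one_pow (by omega), show (2 * k + 1) / 2 = k by omega]
  simp

/-- The map σ multiplies the Gauss sum by the Legendre symbol of u, and z equals the Gauss sum up to
sign; fixing z therefore forces the symbol to be 1. -/
lemma isSquare_of_map_eq_pow {k : ℕ} [Fact (2 * k + 1).Prime] {ζ : L}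
    (hζ : IsPrimitiveRoot ζ (2 * k + 1)) (σ : L →+* L) {u : ℕ} (hu : σ ζ = ζ ^ u)
    (hdvd : ¬ 2 * k + 1 ∣ u) {z : L} (hz : z ^ 2 = (-1) ^ k * (2 * k + 1)) (hσz : σ z = z) :
    IsSquare (u : ZMod (2 * k + 1)) := by
  set g := quadraticGaussSum (2 * k + 1) hζ.pow_eq_one with hg
  have hg2 : g ^ 2 = z ^ 2 := by rw [hz, hg, quadraticGaussSum_sq hζ]
  have hu0 : (u : ZMod (2 * k + 1)) ≠ 0 := by rwa [Ne, ZMod.natCast_eq_zero_iff]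
  have hg0 : g ≠ 0 := by
    rintro h0
    rw [h0, hz] at hg2
    have : (2 * k + 1 : L) ≠ 0 := by exact_mod_cast (by omega : 2 * k + 1 ≠ 0)
    simp [this] at hg2
  have hσg : σ g = g := by
    rcases sq_eq_sq_iff_eq_or_eq_neg.1 hg2 with h | h
    · rw [h, hσz]
    · rw [h, map_neg, hσz]
  have hshift := gaussSum_mulShift ((quadraticChar (ZMod (2 * k + 1))).ringHomComp
    (Int.castRingHom L)) (AddChar.zmodChar (2 * k + 1) hζ.pow_eq_one) (Units.mk0 _ hu0)
  have hmap : σ g = gaussSum ((quadraticChar (ZMod (2 * k + 1))).ringHomComp (Int.castRingHom L))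
      ((AddChar.zmodChar (2 * k + 1) hζ.pow_eq_one).mulShift (u : ZMod (2 * k + 1))) := by
    rw [hg, quadraticGaussSum, gaussSum, gaussSum, map_sum]
    refine Finset.sum_congr rfl fun a _ => ?_
    rw [map_mul, MulChar.ringHomComp_apply, AddChar.mulShift_apply, AddChar.zmodChar_apply, map_pow,
      hu]
    congr 1
    · simp
    · rw [← ZMod.natCast_zmod_val a, ← Nat.cast_mul, AddChar.zmodChar_apply', ← pow_mul,
        ZMod.natCast_zmod_val]
  rw [Units.val_mk0, ← hmap, hσg, ← quadraticGaussSum, ← hg] at hshift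
  have h1 := mul_right_cancel₀ hg0 (hshift.trans (one_mul g).symm)
  rw [MulChar.ringHomComp_apply] at h1
  exact (quadraticChar_one_iff_isSquare hu0).1 (Int.cast_injective (α := L) (by simpa using h1))

end GaussSums

end

section

open Polynomial

/-! ### Subfields of exponent two in cyclotomic fields. -/

section Cyclotomic

lemma eqOn_adjoin {k L : Type*} [Field k] [Field L] [Algebra k L] {S : Set L} {σ τ : L ≃ₐ[k] L}
    (h : Set.EqOn σ τ S) : Set.EqOn σ τ (IntermediateField.adjoin k S) := by
  intro x hx
  induction hx using IntermediateField.adjoin_induction with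
  | mem x hx => exact h hx
  | algebraMap r => simp
  | add x y _ _ hx hy => rw [map_add, map_add, hx, hy]
  | inv x _ hx => rw [map_inv₀, map_inv₀, hx]
  | mul x y _ _ hx hy => rw [map_mul, map_mul, hx, hy]

instance : IsAlgClosure ℚ (AlgebraicClosure ℚ) where
  isAlgClosed := inferInstance
  isAlgebraic := by
    have h := AlgebraicClosure.isAlgebraic ℚ
    rwa [Subsingleton.elim (AlgebraicClosure.instAlgebra ℚ : Algebra ℚ (AlgebraicClosure ℚ))
      DivisionRing.toRatAlgebra] at h

instance : Algebra.IsAlgebraic ℚ (AlgebraicClosure ℚ) := IsAlgClosure.isAlgebraic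

instance : IsGalois ℚ (AlgebraicClosure ℚ) := IsAlgClosure.isGalois ℚ _

/-- A subfield of `ℚ(ζ_N)` on which every automorphism is an involution is generated by roots of
unity of order dividing `8` and square roots of `± p` for the odd primes `p` dividing `N`. -/
theorem le_of_le_cyclotomicSubfield {N : ℕ} (hN : 0 < N)
    {K M : IntermediateField ℚ (AlgebraicClosure ℚ)} (hK : K ≤ cyclotomicSubfield N)
    (hinv : ∀ (σ : AlgebraicClosure ℚ ≃ₐ[ℚ] AlgebraicClosure ℚ), ∀ x ∈ K, σ (σ x) = x)
    (h8 : ∃ ζ ∈ M, IsPrimitiveRoot ζ (N.gcd 8))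
    (hp : ∀ k : ℕ, (2 * k + 1).Prime → 2 * k + 1 ∣ N →
      ∃ z ∈ M, z ^ 2 = (-1) ^ k * (2 * k + 1)) : K ≤ M := by
  have : NeZero N := ⟨hN.ne'⟩
  intro x hx
  rw [← InfiniteGalois.fixedField_fixingSubgroup M, IntermediateField.mem_fixedField_iff]
  intro σ hσ
  rw [IntermediateField.mem_fixingSubgroup_iff] at hσ
  obtain ⟨ζ, hζ⟩ := HasEnoughRootsOfUnity.exists_primitiveRoot (AlgebraicClosure ℚ) N
  obtain ⟨u, -, huN, hu⟩ := (hζ.isPrimitiveRoot_iff).1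
    (hζ.map_of_injective (f := σ) σ.injective)
  -- Fixing M makes u a square modulo each odd p ∣ N and 1 modulo gcd(N, 8). Writing u = r², σ
  -- agrees on ℚ(ζ_N) with τ², where τ sends ζ to ζ^r, and τ² is trivial on K.
  have hsq : IsSquare ((u : ℤ) : ZMod N) := by
    refine isSquare_zmod N hN (fun p hpp hp2 hpN => ⟨fun h => ?_, ?_⟩) ?_
    · have : p ∣ u.gcd N := Nat.dvd_gcd (by exact_mod_cast h) hpN
      rw [Nat.Coprime.gcd_eq_one huN] at this
      exact hpp.one_lt.ne' (Nat.dvd_one.1 this)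
    · obtain ⟨k, rfl⟩ := hpp.odd_of_ne_two hp2
      obtain ⟨z, hzM, hz⟩ := hp k hpp hpN
      have := Fact.mk hpp
      obtain ⟨m, hm⟩ := hpN
      have hζm : IsPrimitiveRoot (ζ ^ m) (2 * k + 1) := hζ.pow hN (by rw [hm, mul_comm])
      have := isSquare_of_map_eq_pow hζm (σ : AlgebraicClosure ℚ →+* AlgebraicClosure ℚ) (u := u)
        (by simp [← hu, ← pow_mul, mul_comm])
        (fun h => by
          have : 2 * k + 1 ∣ u.gcd N := Nat.dvd_gcd h (Dvd.intro _ hm.symm)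
          rw [Nat.Coprime.gcd_eq_one huN] at this
          exact hpp.one_lt.ne' (Nat.dvd_one.1 this)) hz (hσ z hzM)
      simpa using this
    · obtain ⟨ξ, hξM, hξ⟩ := h8
      obtain ⟨m, hm⟩ := Nat.gcd_dvd_left N 8
      have : NeZero (N.gcd 8) := ⟨(Nat.gcd_pos_of_pos_left 8 hN).ne'⟩
      have hζm : IsPrimitiveRoot (ζ ^ m) (N.gcd 8) :=
        hζ.pow hN (by conv_lhs => rw [hm, mul_comm])
      obtain ⟨i, -, -, hi⟩ := (hξ.isPrimitiveRoot_iff).1 hζm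
      have hfix : σ (ζ ^ m) = ζ ^ m := hσ _ (hi ▸ pow_mem hξM i)
      rw [map_pow, ← hu, ← pow_mul, mul_comm, pow_mul] at hfix
      have hfix' : (ζ ^ m) ^ u = (ζ ^ m) ^ 1 := by rw [hfix, pow_one]
      rw [(hζm.isOfFinOrder (NeZero.ne _)).pow_eq_pow_iff_modEq, ← hζm.eq_orderOf] at hfix'
      simpa using (Int.natCast_modEq_iff.2 hfix').symm.dvd
  obtain ⟨r, hr⟩ := hsq
  have hru : IsUnit r := by
    have : IsUnit ((u : ℤ) : ZMod N) := by
      simpa using (ZMod.isUnit_iff_coprime u N).2 huN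
    rw [hr] at this
    exact isUnit_of_mul_isUnit_left this
  have hvN : r.val.Coprime N := by
    rwa [← ZMod.isUnit_iff_coprime, ZMod.natCast_zmod_val]
  have hconj : IsConjRoot ℚ ζ (ζ ^ r.val) := by
    rw [IsConjRoot, ← cyclotomic_eq_minpoly_rat hζ hN,
      ← cyclotomic_eq_minpoly_rat (hζ.pow_of_coprime _ hvN) hN]
  obtain ⟨τ, hτ⟩ := isConjRoot_iff_exists_algEquiv.1 hconj.symm
  have hστ : σ ζ = τ (τ ζ) := by
    rw [hτ, map_pow, hτ, ← pow_mul, ← hu, (hζ.isOfFinOrder hN.ne').pow_eq_pow_iff_modEq,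
      ← hζ.eq_orderOf,
      ← ZMod.natCast_eq_natCast_iff]
    simpa using hr
  have heq : Set.EqOn σ (τ.trans τ) (cyclotomicSubfield N) := by
    refine eqOn_adjoin fun y hy => ?_
    obtain ⟨i, -, -, rfl⟩ := (hζ.isPrimitiveRoot_iff).1 hy
    simp [hστ]
  rw [show σ x = τ (τ x) from heq (hK hx), hinv τ x hx]

/-- Complex conjugation on the algebraic closure of `ℚ`. -/
lemma exists_conj : ∃ (ι : AlgebraicClosure ℚ →ₐ[ℚ] ℂ)
    (c : AlgebraicClosure ℚ ≃ₐ[ℚ] AlgebraicClosure ℚ),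
      ∀ x, ι (c x) = starRingEnd ℂ (ι x) := by
  let ι : AlgebraicClosure ℚ →ₐ[ℚ] ℂ := IsAlgClosed.lift
  let _ : Algebra (AlgebraicClosure ℚ) ℂ := ι.toRingHom.toAlgebra
  have : IsScalarTower ℚ (AlgebraicClosure ℚ) ℂ := IsScalarTower.of_algHom ι
  refine ⟨ι, (Complex.conjAe.restrictScalars ℚ).restrictNormal (AlgebraicClosure ℚ), fun x => ?_⟩
  exact AlgEquiv.restrictNormal_commutes (Complex.conjAe.restrictScalars ℚ) (AlgebraicClosure ℚ) x

end Cyclotomic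

end

section

open WeierstrassCurve WeierstrassCurve.Affine

/-! ### Galois action on torsion points and division fields. -/

section DivisionField

local notation "Ω" => AlgebraicClosure ℚ

noncomputable instance : DecidableEq (AlgebraicClosure ℚ) := Classical.decEq _

/-- The group of points of `E` over the algebraic closure of `ℚ`. -/
abbrev GeomPoint (E : WeierstrassCurve ℚ) : Type := (E.baseChange Ω).toAffine.Point

/-- The action of an automorphism of the algebraic closure of `ℚ` on the points of `E`. -/
noncomputable def galPoint (E : WeierstrassCurve ℚ) (σ : Ω ≃ₐ[ℚ] Ω) : GeomPoint E →+ GeomPoint E :=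
  Point.map (W' := E) (S := ℚ) (σ : Ω →ₐ[ℚ] Ω)

variable {E : WeierstrassCurve ℚ} {σ τ : Ω ≃ₐ[ℚ] Ω} {n : ℕ} {P Q : GeomPoint E}

lemma galPoint_some {x y : Ω} (h : (E.baseChange Ω).toAffine.Nonsingular x y) :
    ∃ h', galPoint E σ (Point.some x y h) = Point.some (σ x) (σ y) h' :=
  ⟨_, Point.map_some ..⟩

lemma galPoint_mul (P : GeomPoint E) : galPoint E (σ * τ) P = galPoint E σ (galPoint E τ P) :=
  (Point.map_map (W' := E) (S := ℚ) (τ : Ω →ₐ[ℚ] Ω) (σ : Ω →ₐ[ℚ] Ω) P).symm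

lemma galPoint_one (P : GeomPoint E) : galPoint E 1 P = P := by
  cases P with
  | zero => exact map_zero _
  | some x y h => exact (galPoint_some h).choose_spec

lemma xCoord_galPoint (P : GeomPoint E) : xCoord (galPoint E σ P) = σ (xCoord P) := by
  cases P with
  | zero => exact (map_zero σ).symm
  | some x y h =>
    obtain ⟨h', e⟩ := galPoint_some (σ := σ) h
    rw [e, xCoord_some, xCoord_some]

lemma nsmul_galPoint (hP : n • P = 0) : n • galPoint E σ P = 0 := by
  rw [← map_nsmul, hP, map_zero]

lemma galPoint_injective : Function.Injective (galPoint E σ) :=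
  Point.map_injective (W' := E) (S := ℚ) (σ : Ω →ₐ[ℚ] Ω)

lemma divisionField_def (E : WeierstrassCurve ℚ) (n : ℕ) : divisionField E n =
  IntermediateField.adjoin ℚ
    {z | ∃ (x y : Ω) (h : (E.baseChange Ω).toAffine.Nonsingular x y),
        n • Point.some x y h = 0 ∧ (z = x ∨ z = y)} := rfl

lemma coord_mem_divisionField {x y : Ω} {h : (E.baseChange Ω).toAffine.Nonsingular x y}
    (hP : n • Point.some x y h = 0) : x ∈ divisionField E n ∧ y ∈ divisionField E n := by
  rw [divisionField_def]
  exact ⟨IntermediateField.subset_adjoin _ _ ⟨x, y, h, hP, Or.inl rfl⟩,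
    IntermediateField.subset_adjoin _ _ ⟨x, y, h, hP, Or.inr rfl⟩⟩

lemma xCoord_mem_divisionField (hP : n • P = 0) : xCoord P ∈ divisionField E n := by
  cases P with
  | zero => exact zero_mem _
  | some x y h => exact (coord_mem_divisionField hP).1

lemma etaCoord_mem_divisionField (hP : n • P = 0) : etaCoord P ∈ divisionField E n := by
  cases P with
  | zero => exact zero_mem _
  | some x y h =>
    obtain ⟨hx, hy⟩ := coord_mem_divisionField hP
    rw [etaCoord_some]
    refine add_mem (add_mem (mul_mem (ofNat_mem _ 2) hy) (mul_mem ?_ hx)) ?_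
    · exact IntermediateField.algebraMap_mem _ _
    · exact IntermediateField.algebraMap_mem _ _

lemma galPoint_eq_of_eqOn (h : Set.EqOn σ τ (divisionField E n)) (hP : n • P = 0) :
    galPoint E σ P = galPoint E τ P := by
  cases P with
  | zero => exact (map_zero _).trans (map_zero _).symm
  | some x y hxy =>
    obtain ⟨h₁, e₁⟩ := galPoint_some (σ := σ) hxy
    obtain ⟨h₂, e₂⟩ := galPoint_some (σ := τ) hxy
    obtain ⟨hx, hy⟩ := coord_mem_divisionField hP
    rw [e₁, e₂, Point.some.injEq]
    exact ⟨h hx, h hy⟩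

lemma eqOn_divisionField (h : ∀ P : GeomPoint E, n • P = 0 → galPoint E σ P = galPoint E τ P) :
    Set.EqOn σ τ (divisionField E n) := by
  rw [divisionField_def]
  refine eqOn_adjoin ?_
  rintro z ⟨x, y, hxy, hP, hz⟩
  obtain ⟨h₁, e₁⟩ := galPoint_some (σ := σ) hxy
  obtain ⟨h₂, e₂⟩ := galPoint_some (σ := τ) hxy
  have := h _ hP
  rw [e₁, e₂, Point.some.injEq] at this
  rcases hz with rfl | rfl
  exacts [this.1, this.2]

lemma divisionField_mono {m n : ℕ} (h : m ∣ n) : divisionField E m ≤ divisionField E n := by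
  rw [divisionField_def E m, IntermediateField.adjoin_le_iff]
  rintro z ⟨x, y, hxy, hP, hz⟩
  obtain ⟨k, rfl⟩ := h
  have hP' : (m * k) • Point.some x y hxy = 0 := by rw [mul_nsmul, hP, nsmul_zero]
  obtain ⟨hx, hy⟩ := coord_mem_divisionField hP'
  rcases hz with rfl | rfl <;> assumption

lemma le_of_forall_fixed {K M : IntermediateField ℚ Ω}
    (h : ∀ σ : Ω ≃ₐ[ℚ] Ω, (∀ x ∈ M, σ x = x) → ∀ x ∈ K, σ x = x) : K ≤ M := by
  intro x hx
  rw [← InfiniteGalois.fixedField_fixingSubgroup M, IntermediateField.mem_fixedField_iff]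
  exact fun σ hσ => h σ ((IntermediateField.mem_fixingSubgroup_iff _ _).1 hσ) x hx

lemma divisionField_mul_le {a b : ℕ} (hab : a.Coprime b) :
    divisionField E (a * b) ≤ divisionField E a ⊔ divisionField E b := by
  refine le_of_forall_fixed fun σ hσ => ?_
  have key : ∀ k : ℕ, divisionField E k ≤ divisionField E a ⊔ divisionField E b →
      ∀ P : GeomPoint E, k • P = 0 → galPoint E σ P = P := by
    intro k hk P hP
    conv_rhs => rw [← galPoint_one P]
    exact galPoint_eq_of_eqOn (fun x hx => hσ x (hk hx)) hP
  refine fun x hx => eqOn_divisionField (n := a * b) (τ := 1) (fun P hP => ?_) hx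
  rw [galPoint_one]
  have hP1 : P = (a.gcdB b : ℤ) • (b • P) + (a.gcdA b : ℤ) • (a • P) := by
    have := Nat.gcd_eq_gcd_ab a b
    rw [hab.gcd_eq_one] at this
    rw [← natCast_zsmul P b, ← natCast_zsmul P a, ← mul_zsmul', ← mul_zsmul', ← add_zsmul]
    conv_lhs => rw [← one_zsmul P]
    congr 1
    push_cast at this
    rw [this]; ring
  rw [hP1, map_add, map_zsmul, map_zsmul, key a le_sup_left (b • P), key b le_sup_right (a • P)]
  · rw [← mul_nsmul, hP]
  · rw [← mul_nsmul', hP]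

instance : Normal ℚ (divisionField E n) := by
  suffices key : ∀ σ : Ω ≃ₐ[ℚ] Ω, (divisionField E n).map (σ : Ω →ₐ[ℚ] Ω) ≤ divisionField E n by
    have := IntermediateField.normal_iff_forall_map_le'.2 key
    convert this
    exact Subsingleton.elim _ _
  intro σ
  rw [divisionField_def E n, IntermediateField.adjoin_map, IntermediateField.adjoin_le_iff,
    ← divisionField_def E n]
  rintro _ ⟨z, ⟨x, y, hxy, hP, hz⟩, rfl⟩
  obtain ⟨h', e⟩ := galPoint_some (σ := σ) hxy
  have hP' := nsmul_galPoint (σ := σ) hP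
  rw [e] at hP'
  obtain ⟨hx, hy⟩ := coord_mem_divisionField hP'
  rcases hz with rfl | rfl
  exacts [hx, hy]

lemma commute_of_isMulCommutative {K : IntermediateField ℚ Ω} [Normal ℚ K]
    (hK : IsMulCommutative Gal(K/ℚ)) (σ τ : Ω ≃ₐ[ℚ] Ω) {x : Ω} (hx : x ∈ K) :
    σ (τ x) = τ (σ x) := by
  have h (σ : Ω ≃ₐ[ℚ] Ω) (y : K) : σ (y : Ω) = (σ.restrictNormal K y : K) :=
    (AlgEquiv.restrictNormal_commutes σ K y).symm
  have := hK.is_comm.comm (σ.restrictNormal K) (τ.restrictNormal K)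
  rw [h τ ⟨x, hx⟩, h σ ⟨x, hx⟩, h, h]
  exact congrArg (Subtype.val) (DFunLike.congr_fun this _)

lemma galPoint_comm (hK : IsMulCommutative Gal(divisionField E n/ℚ)) (σ τ : Ω ≃ₐ[ℚ] Ω)
    (hP : n • P = 0) : galPoint E σ (galPoint E τ P) = galPoint E τ (galPoint E σ P) := by
  rw [← galPoint_mul, ← galPoint_mul]
  exact galPoint_eq_of_eqOn (fun x hx => commute_of_isMulCommutative hK σ τ hx) hP

lemma involution_of_galPoint
    (h : ∀ P : GeomPoint E, n • P = 0 → galPoint E σ (galPoint E σ P) = P)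
    {x : Ω} (hx : x ∈ divisionField E n) : σ (σ x) = x :=
  eqOn_divisionField (σ := σ * σ) (τ := 1)
    (fun P hP => by rw [galPoint_mul, h P hP, galPoint_one]) hx

instance [E.IsElliptic] : (E.baseChange Ω).IsElliptic := inferInstanceAs (E.map _).IsElliptic

lemma exists_sq_eq_mem_divisionField [E.IsElliptic] (k : ℕ) :
    ∃ z ∈ divisionField E (2 * k + 1), z ^ 2 = (-1) ^ k * (2 * k + 1) := by
  refine exists_sq_eq_of_etaCoord_mem (E.baseChange Ω).toAffine
    (divisionField E (2 * k + 1)).toSubfield k ?_ fun P _ hP => etaCoord_mem_divisionField hP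
  have : (E.baseChange Ω).toAffine.Δ = algebraMap ℚ Ω E.Δ := E.map_Δ _
  rw [this]
  exact IntermediateField.algebraMap_mem _ _

lemma exists_sq_eq_mem_divisionField' [E.IsElliptic] {k : ℕ} (h : 2 * k + 1 ∣ n) :
    ∃ z ∈ divisionField E n, z ^ 2 = (-1) ^ k * (2 * k + 1) :=
  let ⟨z, hz, hz'⟩ := exists_sq_eq_mem_divisionField (E := E) k
  ⟨z, divisionField_mono h hz, hz'⟩

lemma cyclotomicSubfield_mono {m n : ℕ} (hn : 0 < n) (h : m ∣ n) :
    cyclotomicSubfield m ≤ cyclotomicSubfield n := by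
  rw [cyclotomicSubfield, IntermediateField.adjoin_le_iff]
  intro z hz
  have : NeZero n := ⟨hn.ne'⟩
  obtain ⟨ζ, hζ⟩ := HasEnoughRootsOfUnity.exists_primitiveRoot (AlgebraicClosure ℚ) n
  have : NeZero m := ⟨(Nat.pos_of_dvd_of_pos h hn).ne'⟩
  obtain ⟨k, hk⟩ := h
  obtain ⟨i, -, -, rfl⟩ := ((hζ.pow hn (by rw [hk, mul_comm] : n = k * m)).isPrimitiveRoot_iff).1 hz
  have : ζ ∈ cyclotomicSubfield n := IntermediateField.subset_adjoin _ _ hζ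
  exact pow_mem (pow_mem this k) i

/-- The Gauss sum is the witness. This serves the oddness of j, where the bounding field is
cyclotomic instead of a division field. -/
lemma exists_sq_eq_mem_cyclotomicSubfield {k : ℕ} (hp : (2 * k + 1).Prime) :
    ∃ z ∈ cyclotomicSubfield (2 * k + 1), z ^ 2 = (-1) ^ k * (2 * k + 1) := by
  have := Fact.mk hp
  have : NeZero (2 * k + 1) := ⟨by omega⟩
  obtain ⟨ζ, hζ⟩ := HasEnoughRootsOfUnity.exists_primitiveRoot (AlgebraicClosure ℚ) (2 * k + 1)
  refine ⟨_, ?_, quadraticGaussSum_sq hζ⟩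
  have hm : ζ ∈ cyclotomicSubfield (2 * k + 1) := IntermediateField.subset_adjoin _ _ hζ
  rw [quadraticGaussSum, gaussSum]
  refine sum_mem fun a _ => mul_mem ?_ ?_
  · exact intCast_mem _ _
  · rw [AddChar.zmodChar_apply]
    exact pow_mem hm _

end DivisionField

end

section

open WeierstrassCurve WeierstrassCurve.Affine

/-! ### The first statement: 4-torsion with ℚ(E[2]) = ℚ(i). -/

section FourTorsion

local notation "Ω" => AlgebraicClosure ℚ

variable {E : WeierstrassCurve ℚ} {ι : AlgebraicClosure ℚ →ₐ[ℚ] ℂ}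
  {c : AlgebraicClosure ℚ ≃ₐ[ℚ] AlgebraicClosure ℚ}

lemma conj_conj (hc : ∀ x, ι (c x) = starRingEnd ℂ (ι x)) (x : Ω) : c (c x) = x :=
  ι.toRingHom.injective (by simp [hc])

lemma conj_of_sq_eq_neg_one (hc : ∀ x, ι (c x) = starRingEnd ℂ (ι x)) {i : Ω} (hi : i ^ 2 = -1) :
    c i = -i := by
  have h : ι i ^ 2 = -1 := by rw [← map_pow, hi, map_neg, map_one]
  have h' : (ι i - Complex.I) * (ι i + Complex.I) = 0 := by
    linear_combination h - Complex.I_sq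
  refine ι.toRingHom.injective ?_
  change ι (c i) = ι (-i)
  rw [hc, map_neg]
  rcases mul_eq_zero.1 h' with h | h
  · rw [sub_eq_zero.1 h, Complex.conj_I]
  · rw [eq_neg_of_add_eq_zero_left h]; simp

lemma galPoint_conj_conj (hc : ∀ x, ι (c x) = starRingEnd ℂ (ι x)) (P : GeomPoint E) :
    galPoint E c (galPoint E c P) = P := by
  rw [← galPoint_mul, show c * c = 1 from AlgEquiv.ext (conj_conj hc), galPoint_one]

lemma exists_sq_eq_neg_one : ∃ i : Ω, i ^ 2 = -1 :=
  IsAlgClosed.exists_pow_nat_eq _ two_pos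

lemma map_sq_eq_neg_one {i : Ω} (hi : i ^ 2 = -1) (σ : Ω ≃ₐ[ℚ] Ω) : σ i = i ∨ σ i = -i :=
  sq_eq_sq_iff_eq_or_eq_neg.1 (by rw [← map_pow, hi, map_neg, map_one])

lemma isPrimitiveRoot_four {i : Ω} (hi : i ^ 2 = -1) : IsPrimitiveRoot i 4 := by
  have h := IsPrimitiveRoot.orderOf i
  rwa [orderOf_eq_prime_pow (p := 2) (n := 1) (x := i) (by rw [pow_one, hi]; norm_num)
    (by rw [pow_succ, pow_one, pow_mul, hi]; norm_num)] at h

lemma odd_dvd_of_dvd_two_pow_mul {k m j : ℕ} (h : 2 * k + 1 ∣ 2 ^ m * j) : 2 * k + 1 ∣ j :=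
  (Nat.Coprime.pow_right m (by simp : Nat.Coprime (2 * k + 1) 2)).dvd_of_dvd_mul_left h

/-- Here σ fixes E[2], and σ - 1 maps E[4] into E[2], so (σ - 1)² = 0 and σ² = 1 + 2(σ - 1) = 1 on
E[4]. -/
lemma galPoint_galPoint_of_fix_gaussian (h2 : divisionField E 2 = gaussianSubfield) {i : Ω}
    (hi : i ^ 2 = -1) {σ : Ω ≃ₐ[ℚ] Ω} (hσ : σ i = i) {P : GeomPoint E} (hP : 4 • P = 0) :
    galPoint E σ (galPoint E σ P) = P := by
  have hfix : ∀ T : GeomPoint E, 2 • T = 0 → galPoint E σ T = T := by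
    intro T hT
    conv_rhs => rw [← galPoint_one T]
    refine galPoint_eq_of_eqOn (n := 2) ?_ hT
    rw [h2]
    refine eqOn_adjoin fun z hz => ?_
    rcases sq_eq_sq_iff_eq_or_eq_neg.1 (hz.trans hi.symm : z ^ 2 = i ^ 2) with rfl | rfl
    · exact hσ
    · simp [hσ]
  have h2P : 2 • (2 • P) = 0 := by rw [← mul_nsmul, hP]
  have hT : 2 • (galPoint E σ P - P) = 0 := by
    rw [nsmul_sub, ← map_nsmul, hfix _ h2P, sub_self]
  have h1 := hfix _ hT
  rw [map_sub] at h1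
  rw [two_nsmul] at hT
  rw [sub_eq_iff_eq_add.1 h1, sub_add_comm, ← sub_eq_zero]
  rw [← hT]
  abel

theorem divisionField_eq_of_gaussian [E.IsElliptic] {j : ℕ}
    (hab : IsMulCommutative Gal(divisionField E 4/ℚ))
    (h2 : divisionField E 2 = gaussianSubfield) (hj : Odd j)
    (hcond : IsConductor (divisionField E 4) (4 * j)) :
    divisionField E (2 * j) = divisionField E (4 * j) := by
  obtain ⟨i, hi⟩ := exists_sq_eq_neg_one
  obtain ⟨ι, c, hc⟩ := exists_conj
  have hinv : ∀ σ : Ω ≃ₐ[ℚ] Ω, ∀ x ∈ divisionField E 4, σ (σ x) = x := by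
    intro σ x hx
    refine involution_of_galPoint (n := 4) (fun P hP => ?_) hx
    rcases map_sq_eq_neg_one hi σ with h | h
    · exact galPoint_galPoint_of_fix_gaussian h2 hi h hP
    -- Both σ and c negate i, so σc fixes it; commutativity gives (σc)² = σ²c² = σ².
    · have := galPoint_galPoint_of_fix_gaussian h2 hi (σ := σ * c)
        (by simp [conj_of_sq_eq_neg_one hc hi, h]) hP
      rw [galPoint_mul, galPoint_mul, ← galPoint_comm hab σ c (nsmul_galPoint hP),
        galPoint_conj_conj hc] at this
      exact this
  have hM : divisionField E 4 ≤ divisionField E (2 * j) := by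
    refine le_of_le_cyclotomicSubfield hcond.1.1 hcond.1.2 hinv ⟨i, ?_, ?_⟩ fun k _ hk => ?_
    · refine divisionField_mono (Dvd.intro j rfl) ?_
      rw [h2]
      exact IntermediateField.subset_adjoin _ _ hi
    · have : (4 * j).gcd 8 = 4 := by
        rw [show 8 = 4 * 2 by rfl, Nat.gcd_mul_left, (Nat.coprime_two_right.2 hj).gcd_eq_one]
      rw [this]
      exact isPrimitiveRoot_four hi
    · exact exists_sq_eq_mem_divisionField'
        ((odd_dvd_of_dvd_two_pow_mul (m := 2) hk).mul_left 2)
  refine le_antisymm (divisionField_mono (mul_dvd_mul_right (by norm_num) j)) ?_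
  refine (divisionField_mul_le ?_).trans (sup_le hM (divisionField_mono (Dvd.intro_left 2 rfl)))
  exact (Nat.Coprime.pow_left 2 (Nat.coprime_two_left.2 hj) : Nat.Coprime (2 ^ 2) j)

end FourTorsion

end

section

open WeierstrassCurve WeierstrassCurve.Affine Polynomial

/-! ### Halving points and the structure of 2-torsion. -/

section Halving

variable {F : Type*} [Field F] {W : WeierstrassCurve.Affine F} {e₁ e₂ e₃ : F}

namespace IsTwoTorsionRoots

variable (h : IsTwoTorsionRoots W e₁ e₂ e₃)

include h

lemma etaCoord_sq {P : W.Point} (hP : P ≠ 0) :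
    etaCoord P ^ 2 = 4 * ((xCoord P - e₁) * (xCoord P - e₂) * (xCoord P - e₃)) := by
  obtain ⟨h1, h2, h3⟩ := h
  rw [_root_.etaCoord_sq hP]
  linear_combination xCoord P ^ 2 * h1 + 2 * xCoord P * h2 + h3

variable [DecidableEq F]

lemma xCoord_eq_or [CharZero F] {P : W.Point} (hP : P ≠ 0) (h2 : 2 • P = 0) :
    xCoord P = e₁ ∨ xCoord P = e₂ ∨ xCoord P = e₃ := by
  have := h.etaCoord_sq hP
  rw [(etaCoord_eq_zero_iff hP).2 h2] at this
  simpa [sub_eq_zero, or_assoc] using this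

lemma two_nsmul_eq_zero {P : W.Point} (hP : P ≠ 0) (hx : xCoord P = e₁) : 2 • P = 0 := by
  rw [← etaCoord_eq_zero_iff hP, ← sq_eq_zero_iff, h.etaCoord_sq hP, hx]
  ring

/-- Thus x(2P) - e₁ is a square in the field of P and of the 2-torsion, the source of the radicals
found in ℚ(E[8]). -/
lemma xCoord_two_nsmul_sub [CharZero F] {P : W.Point} (h2 : 2 • P ≠ 0) :
    (xCoord (2 • P) - e₁) * etaCoord P ^ 2 =
      ((xCoord P - e₁) ^ 2 - (e₁ - e₂) * (e₁ - e₃)) ^ 2 := by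
  have hP : P ≠ 0 := by rintro rfl; simp at h2
  have h8 := h.b₈
  have h0 := h.etaCoord_sq hP
  obtain ⟨h1, h4, h6⟩ := h
  linear_combination xCoord_two_nsmul h2 - e₁ * h0 - xCoord P ^ 2 * h4 - 2 * xCoord P * h6 - h8

lemma xCoord_eq_of_two_nsmul [CharZero F] {P T : W.Point} (hT : T ≠ 0) (hx : xCoord T = e₁)
    (h2 : 2 • P = T) : (xCoord P - e₁) ^ 2 = (e₁ - e₂) * (e₁ - e₃) := by
  have := h.xCoord_two_nsmul_sub (P := P) (by rwa [h2])
  rw [h2, hx, sub_self, zero_mul] at this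
  exact sub_eq_zero.1 (pow_eq_zero_iff two_ne_zero |>.1 this.symm)

end IsTwoTorsionRoots

variable [DecidableEq F]

lemma eq_of_xCoord_eq_of_two_nsmul {s t : W.Point} (hs : s ≠ 0) (ht : t ≠ 0) (h2 : 2 • s = 0)
    (h : xCoord s = xCoord t) : t = s := by
  rcases (xCoord_eq_iff hs ht).1 h with h | h
  · exact h.symm
  · rw [two_nsmul, add_eq_zero_iff_eq_neg] at h2
    rw [← neg_inj, ← h, ← h2]

variable [CharZero F]

lemma two_torsion_cases [IsAlgClosed F] {s t T : W.Point} (h2s : 2 • s = 0) (h2t : 2 • t = 0)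
    (h2T : 2 • T = 0) (hs : s ≠ 0) (ht : t ≠ 0) (hst : s ≠ t) :
    T = 0 ∨ T = s ∨ T = t ∨ T = s + t := by
  by_cases hT : T = 0
  · exact Or.inl hT
  have hst0 : s + t ≠ 0 := by
    intro h0
    apply hst
    rw [two_nsmul, add_eq_zero_iff_eq_neg] at h2t
    rw [eq_neg_of_add_eq_zero_left h0, ← h2t]
  have h2st : 2 • (s + t) = 0 := by rw [nsmul_add, h2s, h2t, add_zero]
  obtain ⟨e₁, e₂, e₃, h⟩ := exists_isTwoTorsionRoots W
  have key : xCoord s = xCoord T ∨ xCoord t = xCoord T ∨ xCoord (s + t) = xCoord T := by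
    have n1 : xCoord s ≠ xCoord t := fun h => hst (eq_of_xCoord_eq_of_two_nsmul hs ht h2s h).symm
    have n2 : xCoord s ≠ xCoord (s + t) := fun h =>
      ht (by simpa using eq_of_xCoord_eq_of_two_nsmul hs hst0 h2s h)
    have n3 : xCoord t ≠ xCoord (s + t) := fun h =>
      hs (by simpa using eq_of_xCoord_eq_of_two_nsmul ht hst0 h2t h)
    have := h.xCoord_eq_or hs h2s
    have := h.xCoord_eq_or ht h2t
    have := h.xCoord_eq_or hst0 h2st
    have := h.xCoord_eq_or hT h2T
    grind
  rcases key with h | h | h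
  · exact Or.inr (Or.inl (eq_of_xCoord_eq_of_two_nsmul hs hT h2s h))
  · exact Or.inr (Or.inr (Or.inl (eq_of_xCoord_eq_of_two_nsmul ht hT h2t h)))
  · exact Or.inr (Or.inr (Or.inr (eq_of_xCoord_eq_of_two_nsmul hst0 hT h2st h)))

variable [W.IsElliptic]

lemma exists_two_nsmul_eq [IsAlgClosed F] (Q : W.Point) : ∃ P : W.Point, 2 • P = Q := by
  by_cases hQ : Q = 0
  · exact ⟨0, by rw [hQ, nsmul_zero]⟩
  obtain ⟨e₁, e₂, e₃, h⟩ := exists_isTwoTorsionRoots W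
  obtain ⟨x, hx⟩ := IsAlgClosed.exists_eval₂_eq_zero (RingHom.id F)
    (X ^ 4 - C W.b₄ * X ^ 2 - C (2 * W.b₆) * X - C W.b₈
      - C (xCoord Q) * (C 4 * X ^ 3 + C W.b₂ * X ^ 2 + C (2 * W.b₄) * X + C W.b₆))
    (by
      have : (X ^ 4 - C W.b₄ * X ^ 2 - C (2 * W.b₆) * X - C W.b₈
        - C (xCoord Q) * (C 4 * X ^ 3 + C W.b₂ * X ^ 2 + C (2 * W.b₄) * X + C W.b₆)).degree
          = 4 := by compute_degree!
      rw [this]; decide)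
  simp at hx
  obtain ⟨P, hP, rfl⟩ := exists_point_xCoord W x
  have hη := etaCoord_sq hP
  -- At a 2-torsion point the denominator of the duplication formula vanishes; its numerator would
  -- vanish too, forcing (e₁ - e₂)(e₁ - e₃) = 0.
  by_cases h2 : 2 • P = 0
  · exfalso
    have key : ∀ e₁ e₂ e₃, IsTwoTorsionRoots W e₁ e₂ e₃ → xCoord P = e₁ → False := by
      intro e₁ e₂ e₃ h hx1
      rw [(etaCoord_eq_zero_iff hP).2 h2] at hη
      have h8 := h.b₈
      have n12 := h.ne₁₂
      have n13 := h.ne₁₃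
      have : ((e₁ - e₂) * (e₁ - e₃)) ^ 2 = 0 := by
        obtain ⟨-, h4, h6⟩ := h
        rw [← hx1] at *
        linear_combination hx - xCoord Q * hη + xCoord P ^ 2 * h4 + 2 * xCoord P * h6 + h8
      simp [sub_eq_zero, n12, n13] at this
    rcases h.xCoord_eq_or hP h2 with hx1 | hx1 | hx1
    · exact key _ _ _ h hx1
    · exact key _ _ _ h.rotate hx1
    · exact key _ _ _ h.rotate.rotate hx1
  · have hη0 := pow_ne_zero 2 (mt (etaCoord_eq_zero_iff hP).1 h2)
    have : xCoord (2 • P) = xCoord Q := by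
      refine mul_right_cancel₀ hη0 ?_
      rw [xCoord_two_nsmul h2, hη]
      linear_combination hx
    rcases (xCoord_eq_iff h2 hQ).1 this with h' | h'
    · exact ⟨P, h'⟩
    · exact ⟨-P, by rw [neg_nsmul, h', neg_neg]⟩

end Halving

end

section

/-! ### Endomorphisms of 8-torsion commuting with an involution. -/

section InvolutionOnTorsion

variable {M : Type*} [AddCommGroup M] {c σ : M →+ M}

lemma addOrderOf_eq_eight {A : M} (h4 : 4 • A ≠ 0) (h8 : 8 • A = 0) : addOrderOf A = 8 :=
  addOrderOf_eq_prime_pow (p := 2) (n := 2) (by simpa using h4) (by simpa using h8)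

/-- Two elements `A` and `B` span the elements killed by `8` if `4 • A` and `4 • B` span those
killed by `2`. -/
lemma exists_zsmul_add_zsmul {A B : M}
    (hcases : ∀ T : M, 2 • T = 0 → T = 0 ∨ T = 4 • A ∨ T = 4 • B ∨ T = 4 • A + 4 • B)
    {P : M} (hP : 8 • P = 0) : ∃ a b : ℤ, P = a • A + b • B := by
  have two : ∀ T : M, 2 • T = 0 → ∃ a b : ℤ, T = (4 * a) • A + (4 * b) • B := by
    intro T hT
    rcases hcases T hT with h | h | h | h
    · exact ⟨0, 0, by simp [h]⟩
    · exact ⟨1, 0, by rw [h]; module⟩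
    · exact ⟨0, 1, by rw [h]; module⟩
    · exact ⟨1, 1, by rw [h]; module⟩
  have four : ∀ T : M, 4 • T = 0 → ∃ a b : ℤ, T = (2 * a) • A + (2 * b) • B := by
    intro T hT
    obtain ⟨a, b, h⟩ := two (2 • T) (by rw [← hT]; module)
    obtain ⟨a', b', h'⟩ := two (T - (2 * a) • A - (2 * b) • B) (by
      have : 2 • (T - (2 * a) • A - (2 * b) • B) = 2 • T - ((4 * a) • A + (4 * b) • B) := by module
      rw [this, h, sub_self])
    refine ⟨a + 2 * a', b + 2 * b', ?_⟩
    have : T = (T - (2 * a) • A - (2 * b) • B) + (2 * a) • A + (2 * b) • B := by module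
    rw [this, h']
    module
  obtain ⟨a, b, h⟩ := four (2 • P) (by rw [← hP]; module)
  obtain ⟨a', b', h'⟩ := two (P - a • A - b • B) (by
    have : 2 • (P - a • A - b • B) = 2 • P - ((2 * a) • A + (2 * b) • B) := by module
    rw [this, h, sub_self])
  refine ⟨a + 4 * a', b + 4 * b', ?_⟩
  have : P = (P - a • A - b • B) + a • A + b • B := by module
  rw [this, h']
  module

/-- With R a fourth part of a suitable P in M[4], A = cR + R and B = cR - R are eigenvectors of c
for 1 and -1, and they form a basis of M[8]. Commuting with c makes the off-diagonal entries of σ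
divisible by 4, injectivity makes the diagonal ones odd, and such a matrix squares to 1 modulo 8. -/
theorem apply_apply_eq_of_commute_involution
    (hdiv : ∀ Q : M, ∃ P, 2 • P = Q) (hc : ∀ P, c (c P) = P)
    (hσ : Function.Injective σ) (hcomm : ∀ P, 8 • P = 0 → c (σ P) = σ (c P))
    (hcases : ∀ s t T : M, 2 • s = 0 → 2 • t = 0 → 2 • T = 0 → s ≠ 0 → t ≠ 0 → s ≠ t →
      T = 0 ∨ T = s ∨ T = t ∨ T = s + t)
    (h2 : ∀ T, 2 • T = 0 → c T = T) (hpos : ∃ P, 4 • P = 0 ∧ c P ≠ P)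
    (hneg : ∃ P, 4 • P = 0 ∧ c P ≠ -P) {P : M} (hP : 8 • P = 0) : σ (σ P) = P := by
  have hdiv4 : ∀ Q : M, ∃ P, 4 • P = Q := by
    intro Q
    obtain ⟨P, rfl⟩ := hdiv Q
    obtain ⟨R, rfl⟩ := hdiv P
    exact ⟨R, by module⟩
  have h2' : ∀ P, 4 • P = 0 → 2 • c P = 2 • P := by
    intro P hP
    rw [← map_nsmul]
    exact h2 _ (by rw [← hP]; module)
  obtain ⟨B, hcB, hB4, hB8⟩ : ∃ B : M, c B = -B ∧ 4 • B ≠ 0 ∧ 8 • B = 0 := by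
    obtain ⟨P, hP, hcP⟩ := hpos
    obtain ⟨R, hR⟩ := hdiv4 P
    have e : 4 • (c R - R) = c P - P := by rw [← hR, map_nsmul]; module
    refine ⟨c R - R, by rw [map_sub, hc]; abel, by rwa [e, sub_ne_zero], ?_⟩
    have : 8 • (c R - R) = 2 • (4 • (c R - R)) := by module
    rw [this, e, nsmul_sub, h2' P hP, sub_self]
  obtain ⟨A, hcA, hA4, hA8⟩ : ∃ A : M, c A = A ∧ 4 • A ≠ 0 ∧ 8 • A = 0 := by
    obtain ⟨P, hP, hcP⟩ := hneg
    obtain ⟨R, hR⟩ := hdiv4 P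
    have e : 4 • (c R + R) = c P + P := by rw [← hR, map_nsmul]; module
    refine ⟨c R + R, by rw [map_add, hc]; abel, ?_, ?_⟩
    · rwa [e, Ne, ← eq_neg_iff_add_eq_zero]
    have : 8 • (c R + R) = 2 • (4 • (c R + R)) := by module
    rw [this, e, nsmul_add, h2' P hP, ← hP]
    module
  -- Otherwise A - B is killed by 4, so 2c(A - B) = 2(A - B), that is 2(A + B) = 2(A - B), and 4B =
  -- 0.
  have hne : 4 • A ≠ 4 • B := by
    intro h
    have h4 : 4 • (A - B) = 0 := by rw [nsmul_sub, h, sub_self]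
    have := h2' _ h4
    rw [map_sub, hcA, hcB, ← sub_eq_zero] at this
    apply hB4
    rw [← this]
    module
  have oA := addOrderOf_eq_eight hA4 hA8
  have oB := addOrderOf_eq_eight hB4 hB8
  have zA (n : ℤ) : n • A = 0 ↔ 8 ∣ n := by
    rw [← addOrderOf_dvd_iff_zsmul_eq_zero, oA]; rfl
  have zB (n : ℤ) : n • B = 0 ↔ 8 ∣ n := by
    rw [← addOrderOf_dvd_iff_zsmul_eq_zero, oB]; rfl
  have span : ∀ P : M, 8 • P = 0 → ∃ a b : ℤ, P = a • A + b • B := fun P hP =>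
    exists_zsmul_add_zsmul (fun T hT => hcases _ _ T (by rw [← hA8]; module)
      (by rw [← hB8]; module) hT hA4 hB4 hne) hP
  have map8 : ∀ P : M, 8 • P = 0 → 8 • σ P = 0 := fun P hP => by rw [← map_nsmul, hP, map_zero]
  have map4 : ∀ P : M, 4 • P ≠ 0 → 4 • σ P ≠ 0 := fun P hP => by
    rw [← map_nsmul]
    exact fun h => hP (hσ (h.trans (map_zero σ).symm))
  obtain ⟨a, b, hab⟩ := span _ (map8 A hA8)
  obtain ⟨a', d, had⟩ := span _ (map8 B hB8)
  have hb : 4 ∣ b := by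
    have h := hcomm A hA8
    rw [hcA, hab, map_add, map_zsmul, map_zsmul, hcA, hcB, ← sub_eq_zero] at h
    have : (2 * b) • B = 0 := by
      rw [← neg_eq_zero, ← h]
      module
    rw [zB] at this
    omega
  have ha' : 4 ∣ a' := by
    have h := hcomm B hB8
    rw [hcB, map_neg, had, map_add, map_zsmul, map_zsmul, hcA, hcB, ← sub_eq_zero] at h
    have : (2 * a') • A = 0 := by
      rw [← h]
      module
    rw [zA] at this
    omega
  have ha : ¬ 2 ∣ a := by
    rintro ⟨k, rfl⟩
    obtain ⟨l, rfl⟩ := hb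
    apply map4 A hA4
    have : 4 • σ A = k • (8 • A) + (2 * l) • (8 • B) := by rw [hab]; module
    rw [this, hA8, hB8, smul_zero, smul_zero, add_zero]
  have hd : ¬ 2 ∣ d := by
    rintro ⟨k, rfl⟩
    obtain ⟨l, rfl⟩ := ha'
    apply map4 B hB4
    have : 4 • σ B = (2 * l) • (8 • A) + k • (8 • B) := by rw [had]; module
    rw [this, hA8, hB8, smul_zero, smul_zero, add_zero]
  obtain ⟨k, rfl⟩ : ∃ k, a = 2 * k + 1 := ⟨a / 2, by omega⟩
  obtain ⟨l, rfl⟩ : ∃ l, d = 2 * l + 1 := ⟨d / 2, by omega⟩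
  obtain ⟨b, rfl⟩ := hb
  obtain ⟨a', rfl⟩ := ha'
  have odd_sq (k : ℤ) : 8 ∣ (2 * k + 1) ^ 2 - 1 := by
    obtain ⟨m, hm⟩ := Int.even_mul_succ_self k
    exact ⟨m, by linear_combination 4 * hm⟩
  obtain ⟨m, hm⟩ := odd_sq k
  obtain ⟨m', hm'⟩ := odd_sq l
  have hA : σ (σ A) = A := by
    rw [hab, map_add, map_zsmul, map_zsmul, hab, had, ← sub_eq_zero]
    have : (2 * k + 1) • ((2 * k + 1) • A + (4 * b) • B) +
        (4 * b) • ((4 * a') • A + (2 * l + 1) • B) - A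
        = (m + 2 * b * a') • (8 • A) + (b * (k + l + 1)) • (8 • B) := by
      rw [← sub_eq_zero]
      have : (((2 * k + 1) ^ 2 - 1) - 8 * m) • A = 0 := by rw [hm, sub_self, zero_smul]
      rw [← this]
      module
    rw [this, hA8, hB8, smul_zero, smul_zero, add_zero]
  have hB : σ (σ B) = B := by
    rw [had, map_add, map_zsmul, map_zsmul, hab, had, ← sub_eq_zero]
    have : (4 * a') • ((2 * k + 1) • A + (4 * b) • B) +
        (2 * l + 1) • ((4 * a') • A + (2 * l + 1) • B) - B
        = (a' * (k + l + 1)) • (8 • A) + (m' + 2 * b * a') • (8 • B) := by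
      rw [← sub_eq_zero]
      have : (((2 * l + 1) ^ 2 - 1) - 8 * m') • B = 0 := by rw [hm', sub_self, zero_smul]
      rw [← this]
      module
    rw [this, hA8, hB8, smul_zero, smul_zero, add_zero]
  obtain ⟨x, y, rfl⟩ := span P hP
  simp only [map_add, map_zsmul, hA, hB]

end InvolutionOnTorsion

end

section

/-! ### Reduction to Fermat's quartic equation. -/

section FermatQuartic

local notation "Ω" => AlgebraicClosure ℚ

variable {ι : AlgebraicClosure ℚ →ₐ[ℚ] ℂ} {c : AlgebraicClosure ℚ ≃ₐ[ℚ] AlgebraicClosure ℚ}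

lemma Rat.pow_four_add_pow_four_ne_sq {a b w : ℚ} (ha : a ≠ 0) (hb : b ≠ 0) :
    a ^ 4 + b ^ 4 ≠ w ^ 2 := by
  intro h
  have e (q : ℚ) : q * q.den = q.num := Rat.mul_den_eq_num q
  have hz (q : ℚ) : (q.den : ℤ) ≠ 0 := by exact_mod_cast q.den_nz
  refine not_fermat_42 (a := a.num * (b.den * w.den)) (b := b.num * (a.den * w.den))
    (c := w.num * ((a.den * b.den) ^ 2 * w.den))
    (mul_ne_zero (Rat.num_ne_zero.2 ha) (mul_ne_zero (hz b) (hz w)))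
    (mul_ne_zero (Rat.num_ne_zero.2 hb) (mul_ne_zero (hz a) (hz w))) ?_
  have : ((a.num * (b.den * w.den) : ℤ) : ℚ) ^ 4 + ((b.num * (a.den * w.den) : ℤ) : ℚ) ^ 4 =
      ((w.num * ((a.den * b.den) ^ 2 * w.den) : ℤ) : ℚ) ^ 2 := by
    push_cast
    rw [← e a, ← e b, ← e w]
    linear_combination (a.den * b.den * w.den : ℚ) ^ 4 * h
  exact_mod_cast this

lemma exists_rat_of_forall_fixed {x : Ω} (hx : ∀ σ : Ω ≃ₐ[ℚ] Ω, σ x = x) :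
    ∃ q : ℚ, algebraMap ℚ Ω q = x := by
  have : IntermediateField.adjoin ℚ {x} ≤ ⊥ := le_of_forall_fixed fun σ _ y hy =>
    eqOn_adjoin (σ := σ) (τ := 1) (S := {x}) (by rintro _ rfl; exact hx σ) hy
  exact IntermediateField.mem_bot.1 (this (IntermediateField.mem_adjoin_simple_self ℚ x))

lemma sq_eq_one_or_conj_eq_neg (hc : ∀ x, ι (c x) = starRingEnd ℂ (ι x)) {ε : Ω}
    (hε : ε ^ 4 = 1) : (ε = 1 ∨ ε = -1) ∨ ε ^ 2 = -1 ∧ c ε = -ε := by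
  have : (ε ^ 2) ^ 2 = 1 := by rw [← pow_mul, hε]
  rcases sq_eq_sq_iff_eq_or_eq_neg.1 (this.trans (one_pow 2).symm) with h | h
  · exact Or.inl (sq_eq_sq_iff_eq_or_eq_neg.1 (h.trans (one_pow 2).symm))
  · exact Or.inr ⟨h, conj_of_sq_eq_neg_one hc h⟩

/-- The square root of `z` times its complex conjugate is real. -/
lemma conj_eq_of_sq_eq_mul_conj (hc : ∀ x, ι (c x) = starRingEnd ℂ (ι x)) {s z : Ω}
    (hs : s ^ 2 = z * c z) : c s = s := by
  have h1 : (c s) ^ 2 = s ^ 2 := by rw [← map_pow, hs, map_mul, conj_conj hc, mul_comm]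
  rcases sq_eq_sq_iff_eq_or_eq_neg.1 h1 with h | h
  · exact h
  have h2 : s * c s + z * c z = 0 := by rw [h, ← hs]; ring
  have h3 : ι (s * c s + z * c z) = 0 := by rw [h2, map_zero]
  rw [map_add, map_mul, map_mul, hc, hc, Complex.mul_conj, Complex.mul_conj] at h3
  have h4 : Complex.normSq (ι s) + Complex.normSq (ι z) = 0 := by exact_mod_cast h3
  have h5 : Complex.normSq (ι s) = 0 :=
    ((add_eq_zero_iff_of_nonneg (Complex.normSq_nonneg _) (Complex.normSq_nonneg _)).1 h4).1
  have h6 : s = 0 := ι.toRingHom.injective (by simpa using h5)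
  rw [h6, map_zero]

/-- If complex conjugation exchanges `e₂` and `e₃`, then radicals `g`, `h`, `F` as below, on which
conjugation commutes with all automorphisms, would yield a rational solution of Fermat's equation
`x⁴ + y⁴ = z²`. -/
lemma false_of_conj_swap (hc : ∀ x, ι (c x) = starRingEnd ℂ (ι x)) {e₁ e₂ e₃ g h F : Ω}
    (n12 : e₁ ≠ e₂) (n13 : e₁ ≠ e₃) (n23 : e₂ ≠ e₃) (h1 : ∀ σ : Ω ≃ₐ[ℚ] Ω, σ e₁ = e₁)
    (h23 : ∀ σ : Ω ≃ₐ[ℚ] Ω, σ e₂ = e₂ ∧ σ e₃ = e₃ ∨ σ e₂ = e₃ ∧ σ e₃ = e₂)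
    (hc2 : c e₂ = e₃) (hc3 : c e₃ = e₂)
    (hgc : ∀ σ : Ω ≃ₐ[ℚ] Ω, σ (c g) = c (σ g)) (hhc : ∀ σ : Ω ≃ₐ[ℚ] Ω, σ (c h) = c (σ h))
    (hFc : ∀ σ : Ω ≃ₐ[ℚ] Ω, σ (c F) = c (σ F)) (hg : g ^ 4 = (e₁ - e₂) * (e₁ - e₃))
    (hh : h ^ 2 = e₁ + g ^ 2 - e₂) (hF : F ^ 4 = (e₂ - e₁) * (e₂ - e₃)) : False := by
  have hg0 : g ≠ 0 := by
    rintro rfl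
    simp [sub_eq_zero, n12, n13, eq_comm] at hg
  have hF0 : F ≠ 0 := by
    rintro rfl
    simp [sub_eq_zero, n12.symm, n23, eq_comm] at hF
  have hcs : c (g ^ 2) = g ^ 2 :=
    conj_eq_of_sq_eq_mul_conj hc (z := e₁ - e₂) (by rw [map_sub, h1, hc2, ← hg]; ring)
  -- The ratio σg/g is a fourth root of unity, and it is real because cg = ±g and σ commutes with c
  -- on g; so it is ±1.
  have hs : ∀ σ : Ω ≃ₐ[ℚ] Ω, σ (g ^ 2) = g ^ 2 := by
    intro σ
    have h4 : (σ g) ^ 4 = g ^ 4 := by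
      rw [← map_pow, hg, map_mul, map_sub, map_sub, h1]
      rcases h23 σ with ⟨h2, h3⟩ | ⟨h2, h3⟩ <;> rw [h2, h3]
      ring
    have hε : (σ g / g) ^ 4 = 1 := by rw [div_pow, h4, div_self (pow_ne_zero 4 hg0)]
    have hcε : c (σ g / g) = σ g / g := by
      rw [map_div₀, ← hgc]
      rcases sq_eq_sq_iff_eq_or_eq_neg.1 (by rw [← map_pow, hcs] : (c g) ^ 2 = g ^ 2) with h | h
      · rw [h]
      · rw [h, map_neg, neg_div_neg_eq]
    have hσ : σ g = σ g / g * g := (div_mul_cancel₀ _ hg0).symm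
    rcases sq_eq_one_or_conj_eq_neg hc hε with (h | h) | ⟨h, h'⟩
    · rw [map_pow, hσ, h]; ring
    · rw [map_pow, hσ, h]; ring
    · rw [hcε, self_eq_neg] at h'
      rw [h'] at h
      norm_num at h
  -- One of σ and σc fixes both e₂ and e₃, and the two agree on a real z.
  have ext : ∀ z : Ω, c z = z → (∀ σ : Ω ≃ₐ[ℚ] Ω, σ e₂ = e₂ → σ e₃ = e₃ → σ z = z) →
      ∃ q : ℚ, algebraMap ℚ Ω q = z := by
    intro z hz hfix
    refine exists_rat_of_forall_fixed fun σ => ?_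
    rcases h23 σ with ⟨h2, h3⟩ | ⟨h2, h3⟩
    · exact hfix σ h2 h3
    · have := hfix (σ * c) (by simp [hc2, h3]) (by simp [hc3, h2])
      rwa [AlgEquiv.mul_apply, hz] at this
  obtain ⟨s, hs⟩ := exists_rat_of_forall_fixed hs
  obtain ⟨m, hm⟩ := ext (h * c h) (by rw [map_mul, conj_conj hc, mul_comm]) (by
    intro σ h2 _
    have : (σ h) ^ 2 = h ^ 2 := by rw [← map_pow, hh, map_sub, map_add, h1, h2, ← hs]; simp
    rw [map_mul, hhc]
    rcases sq_eq_sq_iff_eq_or_eq_neg.1 this with h | h <;> rw [h]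
    rw [map_neg, neg_mul_neg])
  obtain ⟨N, hN⟩ := ext (F * c F) (by rw [map_mul, conj_conj hc, mul_comm]) (by
    intro σ h2 h3
    have h4 : (σ F) ^ 4 = F ^ 4 := by
      rw [← map_pow, hF, map_mul, map_sub, map_sub, h1, h2, h3]
    have hε : (σ F / F) ^ 4 = 1 := by rw [div_pow, h4, div_self (pow_ne_zero 4 hF0)]
    have hσ : σ F = σ F / F * F := (div_mul_cancel₀ _ hF0).symm
    rw [map_mul, hFc, hσ, map_mul]
    rcases sq_eq_one_or_conj_eq_neg hc hε with (h | h) | ⟨h, h'⟩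
    · rw [h, map_one, one_mul, one_mul]
    · rw [h, map_neg, map_one]; ring
    · rw [h']
      linear_combination -F * c F * h)
  have hch : (c h) ^ 2 = e₁ + g ^ 2 - e₃ := by
    rw [← map_pow, hh, map_sub, map_add, h1, hc2, hcs]
  have hcF : (c F) ^ 4 = (e₃ - e₁) * (e₃ - e₂) := by
    rw [← map_pow, hF, map_mul, map_sub, map_sub, h1, hc2, hc3]
  have hm0 : m ≠ 0 := by
    rintro rfl
    rw [map_zero] at hm
    have : (h * c h) ^ 2 = 0 := by rw [← hm]; ring
    rw [mul_pow, hh, hch] at this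
    rcases mul_eq_zero.1 this with h0 | h0
    · have : (e₁ - e₂) * (e₂ - e₃) = 0 := by linear_combination (g ^ 2 - (e₁ - e₂)) * h0 - hg
      simp [sub_eq_zero, n12, n23] at this
    · have : (e₁ - e₃) * (e₃ - e₂) = 0 := by linear_combination (g ^ 2 - (e₁ - e₃)) * h0 - hg
      simp [sub_eq_zero, n13, n23.symm] at this
  have hN0 : N ≠ 0 := by
    rintro rfl
    rw [map_zero] at hN
    rcases mul_eq_zero.1 hN.symm with h0 | h0
    · exact hF0 h0
    · exact hF0 (by simpa using h0)
  -- With a = e₁ - e₂, b = e₁ - e₃ and s² = ab, one has m² = s(2s + a + b) and N⁴ = -s²(a - b)², so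
  -- m⁴ + N⁴ = 4s²(s² + s(a + b) + ab) = (2sm)².
  refine Rat.pow_four_add_pow_four_ne_sq (w := 2 * s * m) hm0 hN0
    ((algebraMap ℚ Ω).injective ?_)
  simp only [map_add, map_pow, map_mul, hs, hm, hN, map_ofNat]
  have e1 : (h * c h) ^ 2 = (e₁ + g ^ 2 - e₂) * (e₁ + g ^ 2 - e₃) := by rw [mul_pow, hh, hch]
  have e2 : (F * c F) ^ 4 = (e₂ - e₁) * (e₂ - e₃) * ((e₃ - e₁) * (e₃ - e₂)) := by
    rw [mul_pow, hF, hcF]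
  rw [show (h * c h) ^ 4 = ((h * c h) ^ 2) ^ 2 by ring, mul_pow _ (h * c h), e1, e2]
  linear_combination (-2 * g ^ 2 * (2 * g ^ 2 + (e₁ - e₂) + (e₁ - e₃)) + g ^ 4
    - (e₁ - e₂) * (e₁ - e₃) + (e₃ - e₂) ^ 2) * hg

end FermatQuartic

end

section

open WeierstrassCurve WeierstrassCurve.Affine

/-! ### The second statement: abelian 8-torsion. -/

section EightTorsion

local notation "Ω" => AlgebraicClosure ℚ

variable {E : WeierstrassCurve ℚ} {ι : AlgebraicClosure ℚ →ₐ[ℚ] ℂ}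
  {c : AlgebraicClosure ℚ ≃ₐ[ℚ] AlgebraicClosure ℚ} {e₁ e₂ e₃ : AlgebraicClosure ℚ}

lemma galPoint_ne_zero {σ : Ω ≃ₐ[ℚ] Ω} {P : GeomPoint E} (hP : P ≠ 0) : galPoint E σ P ≠ 0 :=
  fun h => hP (galPoint_injective (h.trans (map_zero (galPoint E σ)).symm))

lemma exists_conj_ne_self (hc : ∀ x, ι (c x) = starRingEnd ℂ (ι x)) {i : Ω}
    (hi : i ∈ divisionField E 4) (hi2 : i ^ 2 = -1) :
    ∃ P : GeomPoint E, 4 • P = 0 ∧ galPoint E c P ≠ P := by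
  by_contra! hpos
  have : c i = i := eqOn_divisionField (σ := c) (τ := 1) (n := 4)
    (fun P hP => by rw [hpos P hP, galPoint_one]) hi
  rw [conj_of_sq_eq_neg_one hc hi2, neg_eq_self] at this
  rw [this] at hi2
  norm_num at hi2

variable [E.IsElliptic]

lemma IsTwoTorsionRoots.exists_point (h : IsTwoTorsionRoots (E.baseChange Ω).toAffine e₁ e₂ e₃) :
    ∃ T : GeomPoint E, T ≠ 0 ∧ xCoord T = e₁ ∧ 2 • T = 0 := by
  obtain ⟨T, hT, hx⟩ := exists_point_xCoord (E.baseChange Ω).toAffine e₁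
  exact ⟨T, hT, hx, h.two_nsmul_eq_zero hT hx⟩

lemma IsTwoTorsionRoots.map_eq_or (h : IsTwoTorsionRoots (E.baseChange Ω).toAffine e₁ e₂ e₃)
    (σ : Ω ≃ₐ[ℚ] Ω) : σ e₁ = e₁ ∨ σ e₁ = e₂ ∨ σ e₁ = e₃ := by
  obtain ⟨T, hT, rfl, h2⟩ := h.exists_point
  rw [← xCoord_galPoint]
  exact h.xCoord_eq_or (galPoint_ne_zero hT) (nsmul_galPoint h2)

lemma IsTwoTorsionRoots.mem_divisionField
    (h : IsTwoTorsionRoots (E.baseChange Ω).toAffine e₁ e₂ e₃) {n : ℕ} (hn : 2 ∣ n) :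
    e₁ ∈ divisionField E n := by
  obtain ⟨T, hT, rfl, h2⟩ := h.exists_point
  exact divisionField_mono hn (xCoord_mem_divisionField h2)

/-- Complex conjugation does not act as `-1` on the points killed by `4`, if it fixes those killed
by `2`. -/
lemma exists_conj_ne_neg (hc : ∀ x, ι (c x) = starRingEnd ℂ (ι x))
    (h2 : ∀ T : GeomPoint E, 2 • T = 0 → galPoint E c T = T) :
    ∃ P : GeomPoint E, 4 • P = 0 ∧ galPoint E c P ≠ -P := by
  by_contra! hneg
  obtain ⟨e₁, e₂, e₃, h⟩ := exists_isTwoTorsionRoots (E.baseChange Ω).toAffine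
  have key : ∀ e₁ e₂ e₃, IsTwoTorsionRoots (E.baseChange Ω).toAffine e₁ e₂ e₃ →
      c e₁ = e₁ ∧ ∃ x, c x = x ∧ (x - e₁) ^ 2 = (e₁ - e₂) * (e₁ - e₃) := by
    intro e₁ e₂ e₃ h
    obtain ⟨T, hT, hx, hT2⟩ := h.exists_point
    obtain ⟨R, hR⟩ := exists_two_nsmul_eq T
    have hR4 : 4 • R = 0 := by
      rw [← hT2, ← hR, ← mul_nsmul]
    refine ⟨by rw [← hx, ← xCoord_galPoint, h2 T hT2], xCoord R, ?_,
      h.xCoord_eq_of_two_nsmul hT hx hR⟩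
    rw [← xCoord_galPoint, hneg R hR4, xCoord_neg]
  obtain ⟨c1, x, cx, hx⟩ := key _ _ _ h
  obtain ⟨c2, y, cy, hy⟩ := key _ _ _ h.rotate
  obtain ⟨c3, z, cz, hz⟩ := key _ _ _ h.rotate.rotate
  have n12 := sub_ne_zero.2 h.ne₁₂
  have n13 := sub_ne_zero.2 h.ne₁₃
  have n23 := sub_ne_zero.2 h.ne₂₃
  -- If c were -1 on E[4], halves of the three 2-torsion points would have real x-coordinates,
  -- making w a real square root of -1.
  set w := (x - e₁) * (y - e₂) * (z - e₃) / ((e₁ - e₂) * (e₁ - e₃) * (e₂ - e₃)) with hw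
  have hw2 : w ^ 2 = -1 := by
    rw [hw, div_pow, mul_pow, mul_pow, hx, hy, hz]
    field_simp
    ring
  have hcw : c w = w := by simp [hw, c1, c2, c3, cx, cy, cz]
  rw [conj_of_sq_eq_neg_one hc hw2, neg_eq_self] at hcw
  rw [hcw] at hw2
  norm_num at hw2

/-- A square root of `x(Q) - e₁` for a point `Q` killed by `4` lies in `ℚ(E[8])`. -/
lemma IsTwoTorsionRoots.exists_sq_mem_divisionField
    (h : IsTwoTorsionRoots (E.baseChange Ω).toAffine e₁ e₂ e₃) {Q : GeomPoint E} (hQ : Q ≠ 0)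
    (hQ4 : 4 • Q = 0) : ∃ f ∈ divisionField E 8, f ^ 2 = xCoord Q - e₁ := by
  obtain ⟨P, rfl⟩ := exists_two_nsmul_eq Q
  have hP8 : 8 • P = 0 := by rw [← hQ4, ← mul_nsmul]
  have hP : P ≠ 0 := by rintro rfl; exact hQ (nsmul_zero 2)
  have hη := mt (etaCoord_eq_zero_iff hP).1 hQ
  have he1 := h.mem_divisionField (n := 8) (by norm_num)
  have he2 := h.rotate.mem_divisionField (n := 8) (by norm_num)
  have he3 := h.rotate.rotate.mem_divisionField (n := 8) (by norm_num)
  refine ⟨((xCoord P - e₁) ^ 2 - (e₁ - e₂) * (e₁ - e₃)) / etaCoord P, ?_, ?_⟩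
  · exact div_mem (sub_mem (pow_mem (sub_mem (xCoord_mem_divisionField hP8) he1) 2)
      (mul_mem (sub_mem he1 he2) (sub_mem he1 he3))) (etaCoord_mem_divisionField hP8)
  · rw [div_pow, ← h.xCoord_two_nsmul_sub hQ, mul_div_cancel_right₀ _ (pow_ne_zero 2 hη)]

/-- The radicals for `false_of_conj_swap` are square roots of x(Q₁) - e₁, x(Q₁) - e₂ and x(Q₂) - e₂,
with Q₁, Q₂ halves of two points of order two. They lie in ℚ(E[8]), so c commutes with every
automorphism on them. -/
lemma not_conj_swap (hc : ∀ x, ι (c x) = starRingEnd ℂ (ι x))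
    (hab : IsMulCommutative Gal(divisionField E 8/ℚ))
    (h : IsTwoTorsionRoots (E.baseChange Ω).toAffine e₁ e₂ e₃) (hc1 : c e₁ = e₁)
    (hc2 : c e₂ = e₃) : False := by
  have n12 := h.ne₁₂
  have n13 := h.ne₁₃
  have n23 := h.ne₂₃
  have hc3 : c e₃ = e₂ := by rw [← hc2, conj_conj hc]
  have comm : ∀ x ∈ divisionField E 8, ∀ σ : Ω ≃ₐ[ℚ] Ω, σ (c x) = c (σ x) :=
    fun x hx σ => commute_of_isMulCommutative hab σ c hx
  have h1 : ∀ σ : Ω ≃ₐ[ℚ] Ω, σ e₁ = e₁ := by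
    -- As e₁ is the only root fixed by c, any σ commuting with c fixes it.
    intro σ
    have := comm e₁ (h.mem_divisionField (by norm_num)) σ
    rw [hc1] at this
    rcases h.map_eq_or σ with h | h | h
    · exact h
    · rw [h, hc2] at this; exact absurd this n23
    · rw [h, hc3] at this; exact absurd this.symm n23
  have h23 : ∀ σ : Ω ≃ₐ[ℚ] Ω, σ e₂ = e₂ ∧ σ e₃ = e₃ ∨ σ e₂ = e₃ ∧ σ e₃ = e₂ := by
    intro σ
    have := h.rotate.map_eq_or σ
    have := h.rotate.rotate.map_eq_or σ
    have := h1 σ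
    have := σ.injective.ne n12
    have := σ.injective.ne n13
    have := σ.injective.ne n23
    grind
  have half : ∀ T : GeomPoint E, T ≠ 0 → 2 • T = 0 → ∃ Q : GeomPoint E, 2 • Q = T ∧ Q ≠ 0 ∧
      4 • Q = 0 := by
    intro T hT hT2
    obtain ⟨Q, rfl⟩ := exists_two_nsmul_eq T
    exact ⟨Q, rfl, by rintro rfl; exact hT (nsmul_zero 2), by rw [← hT2, ← mul_nsmul]⟩
  obtain ⟨T₁, hT₁, hx₁, h2T₁⟩ := h.exists_point
  obtain ⟨Q₁, hQ₁, hQ₁0, hQ₁4⟩ := half T₁ hT₁ h2T₁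
  obtain ⟨T₂, hT₂, hx₂, h2T₂⟩ := h.rotate.exists_point
  obtain ⟨Q₂, hQ₂, hQ₂0, hQ₂4⟩ := half T₂ hT₂ h2T₂
  obtain ⟨g, hgK, hg⟩ := h.exists_sq_mem_divisionField hQ₁0 hQ₁4
  obtain ⟨r, hrK, hr⟩ := h.rotate.exists_sq_mem_divisionField hQ₁0 hQ₁4
  obtain ⟨f, hfK, hf⟩ := h.rotate.exists_sq_mem_divisionField hQ₂0 hQ₂4
  refine false_of_conj_swap hc n12 n13 n23 h1 h23 hc2 hc3 (comm g hgK) (comm r hrK) (comm f hfK)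
    ?_ ?_ ?_
  · rw [← h.xCoord_eq_of_two_nsmul hT₁ hx₁ hQ₁, ← hg]; ring
  · rw [hr, hg]; ring
  · rw [mul_comm, ← h.rotate.xCoord_eq_of_two_nsmul hT₂ hx₂ hQ₂, ← hf]; ring

/-- If `ℚ(E[8])` is abelian then complex conjugation fixes the points killed by `2`. -/
lemma galPoint_conj_eq_self (hc : ∀ x, ι (c x) = starRingEnd ℂ (ι x))
    (hab : IsMulCommutative Gal(divisionField E 8/ℚ)) {T : GeomPoint E} (hT : 2 • T = 0) :
    galPoint E c T = T := by
  obtain ⟨e₁, e₂, e₃, h⟩ := exists_isTwoTorsionRoots (E.baseChange Ω).toAffine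
  -- An involution of three roots is trivial or a transposition; the rotations of `h` exclude all
  -- three transpositions.
  have key : c e₁ = e₁ ∧ c e₂ = e₂ ∧ c e₃ = e₃ := by
    have := h.map_eq_or c
    have := h.rotate.map_eq_or c
    have := h.rotate.rotate.map_eq_or c
    have := fun h' => not_conj_swap hc hab h h'
    have := fun h' => not_conj_swap hc hab h.rotate h'
    have := fun h' => not_conj_swap hc hab h.rotate.rotate h'
    have := conj_conj hc e₁
    have := conj_conj hc e₂
    have := conj_conj hc e₃
    have := c.injective.ne h.ne₁₂
    have := c.injective.ne h.ne₁₃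
    have := c.injective.ne h.ne₂₃
    grind
  by_cases hT0 : T = 0
  · rw [hT0, map_zero]
  refine (eq_of_xCoord_eq_of_two_nsmul hT0 (galPoint_ne_zero hT0) hT ?_)
  rw [xCoord_galPoint]
  rcases h.xCoord_eq_or hT0 hT with hx | hx | hx <;> rw [hx]
  exacts [key.1.symm, key.2.1.symm, key.2.2.symm]

theorem odd_and_divisionField_eq {j : ℕ} (hab : IsMulCommutative Gal(divisionField E 8/ℚ))
    (hζ : ∃ ζ ∈ divisionField E 4, IsPrimitiveRoot ζ 8)
    (hcond : IsConductor (divisionField E 8) (8 * j)) :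
    Odd j ∧ divisionField E (4 * j) = divisionField E (8 * j) := by
  obtain ⟨ι, c, hc⟩ := exists_conj
  obtain ⟨ζ, hζE, hζ⟩ := hζ
  have hi : (ζ ^ 2) ^ 2 = -1 := by
    rw [← pow_mul]
    have h4 : (ζ ^ (2 * 2)) ^ 2 = 1 ^ 2 := by rw [← pow_mul, hζ.pow_eq_one, one_pow]
    refine (sq_eq_sq_iff_eq_or_eq_neg.1 h4).resolve_left ?_
    exact hζ.pow_ne_one_of_pos_of_lt (by norm_num) (by norm_num)
  have h2 : ∀ T : GeomPoint E, 2 • T = 0 → galPoint E c T = T := fun T hT =>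
    galPoint_conj_eq_self hc hab hT
  have hinv : ∀ σ : Ω ≃ₐ[ℚ] Ω, ∀ x ∈ divisionField E 8, σ (σ x) = x := by
    intro σ x hx
    refine involution_of_galPoint (n := 8) (fun P hP => ?_) hx
    exact apply_apply_eq_of_commute_involution exists_two_nsmul_eq (galPoint_conj_conj hc)
      galPoint_injective (fun P hP => galPoint_comm hab c σ hP)
      (fun s t T hs ht hT => two_torsion_cases hs ht hT) h2
      (exists_conj_ne_self hc (pow_mem hζE 2) hi) (exists_conj_ne_neg hc h2) hP
  have hj0 : 0 < j := by have := hcond.1.1; omega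
  have hgcd : (8 * j).gcd 8 = 8 := Nat.gcd_eq_right (Dvd.intro j rfl)
  have hodd : Odd j := by
    obtain ⟨k, m, hm, rfl⟩ := Nat.exists_eq_two_pow_mul_odd hj0.ne'
    have hm0 : 0 < 8 * m := by have := hm.pos; omega
    -- The generators see only the odd primes of j and ζ₈, so the factor 2^k of j is superfluous and
    -- minimality gives k = 0.
    have hle : divisionField E 8 ≤ cyclotomicSubfield (8 * m) := by
      refine le_of_le_cyclotomicSubfield hcond.1.1 hcond.1.2 hinv ⟨ζ, ?_, by rwa [hgcd]⟩
        fun l hl hdvd => ?_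
      · exact cyclotomicSubfield_mono hm0 (Dvd.intro m rfl)
          (IntermediateField.subset_adjoin _ _ hζ)
      · obtain ⟨z, hz, hz2⟩ := exists_sq_eq_mem_cyclotomicSubfield hl
        refine ⟨z, cyclotomicSubfield_mono hm0 (Dvd.dvd.mul_left ?_ 8) hz, hz2⟩
        exact odd_dvd_of_dvd_two_pow_mul (odd_dvd_of_dvd_two_pow_mul (m := 3) hdvd)
    have := hcond.2 ⟨hm0, hle⟩
    have : 2 ^ k * m ≤ 1 * m := by omega
    have := Nat.le_of_mul_le_mul_right this hm.pos
    have : k = 0 := by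
      by_contra hk
      have := Nat.one_lt_two_pow hk
      omega
    rwa [this, pow_zero, one_mul]
  have hM : divisionField E 8 ≤ divisionField E (4 * j) := by
    refine le_of_le_cyclotomicSubfield hcond.1.1 hcond.1.2 hinv ⟨ζ, ?_, by rwa [hgcd]⟩
      fun l hl hdvd => ?_
    · exact divisionField_mono (Dvd.intro j rfl) hζE
    · exact exists_sq_eq_mem_divisionField'
        ((odd_dvd_of_dvd_two_pow_mul (m := 3) hdvd).mul_left 4)
  refine ⟨hodd, le_antisymm (divisionField_mono (mul_dvd_mul_right (by norm_num) j)) ?_⟩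
  refine (divisionField_mul_le ?_).trans (sup_le hM (divisionField_mono (Dvd.intro_left 4 rfl)))
  exact (Nat.Coprime.pow_left 3 (Nat.coprime_two_left.2 hodd) : Nat.Coprime (2 ^ 3) j)

end EightTorsion

end

theorem mainTheorem12 :
    (∀ (E : WeierstrassCurve ℚ) [E.IsElliptic] (j : ℕ),
      IsMulCommutative Gal(divisionField E 4/ℚ) →
      divisionField E 2 = gaussianSubfield →
      Odd j →
      IsConductor (divisionField E 4) (4 * j) →
      divisionField E (2 * j) = divisionField E (4 * j)) ∧
    (∀ (E : WeierstrassCurve ℚ) [E.IsElliptic] (j : ℕ),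
      IsMulCommutative Gal(divisionField E 8/ℚ) →
      (∃ ζ ∈ divisionField E 4, IsPrimitiveRoot ζ 8) →
      IsConductor (divisionField E 8) (8 * j) →
      Odd j ∧ divisionField E (4 * j) = divisionField E (8 * j)) :=
  ⟨fun _ _ _ hab h2 hj hcond => divisionField_eq_of_gaussian hab h2 hj hcond,
    fun _ _ _ hab hζ hcond => odd_and_divisionField_eq hab hζ hcond⟩
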